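/- Let $\Lambda<0$ and let $(F,\sigma)$ be a (non-empty) smooth two-dimensional Riemannian manifold of constant Gauss curvature $\varepsilon\in\{-1,0,1\}$; in particular $F$ may be the round sphere $\mathbb S^2$ ($\varepsilon=1$), a flat torus $\mathbb T^2=\mathbb S^1\times\mathbb S^1$ ($\varepsilon=0$), the hyperbolic plane $H^2$ ($\varepsilon=-1$), or a compact quotient of these. Consider a spatially homogeneous spacetime $$M=I\times\mathbb S^1\times F,\qquad g=-dt^2+a(t)^2\,dz^2+b(t)^2\,\sigma,$$ with $I\subseteq\mathbb R$ a non-empty open interval and $a,b>0$, together with a homogeneous massless scalar field $\phi=\phi(t)$ (with $a,b,\phi$ of class $C^2$ on $I$), which solves the Einstein--scalar field equations $$\mathrm{Ric}-\tfrac12 R\,g+\Lambda g=8\pi T,\qquad T_{\mu\nu}=\partial_\mu\phi\,\partial_\nu\phi-\tfrac12 g_{\mu\nu}\,g^{\alpha\beta}\partial_\alpha\phi\,\partial_\beta\phi,\qquad \nabla^\mu\nabla_\mu\phi=0 .$$ Assume that the solution is maximal, i.e. it cannot be extended as a solution of this form to a larger time interval, and that the scalar field is nontrivial, i.e. $\dot\phi$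 does not vanish identically. Then: 1. $I=(T_-,T_+)$ is a bounded interval. 2. The slices $\{t\}\times\mathbb S^1\times F$, $t\in I$, form a foliation of $M$ by spacelike hypersurfaces of constant mean curvature (a CMC foliation), and the mean curvature of the leaves takes all real values. With the mean curvature taken as the divergence of the future-directed unit normal, it tends to $+\infty$ as $t\to T_-$ and to $-\infty$ as $t\to T_+$ (both singularities are crushing). 3. The past and the future singularity are curvature singularities: the Kretschmann scalar $R^{\alpha\beta\gamma\delta}R_{\alpha\beta\gamma\delta}$ tends to $+\infty$, uniformly on the slices, as $t\to T_-$ and as $t\to T_+$. 4. The spacetime recollapses: every $C^1$ timelike curve in $M$ has proper length at most $T_+-T_-$; in particular all timelike geodesics are past and future incomplete. -/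

import Mathlib

open scoped Manifold ContDiff Topology
open Filter Set

noncomputable section

namespace Recollapse

/-! ### Tensor calculus of a (pseudo-)Riemannian metric in local coordinates

A metric is given by its matrix of components `g x` at the coordinate point `x`. -/

section Coordinates

variable {n : ℕ}

/-- The partial derivative `∂ᵢ f` at `x`. -/
def pd (i : Fin n) (f : EuclideanSpace ℝ (Fin n) → ℝ) (x : EuclideanSpace ℝ (Fin n)) : ℝ :=
  lineDeriv ℝ f x (EuclideanSpace.single i 1)

/-- The Christoffel symbol `Γᵏᵢⱼ` of the Levi-Civita connection. -/
def christoffel (g : EuclideanSpace ℝ (Fin n) → Matrix (Fin n) (Fin n) ℝ) (k i j : Fin n)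
    (x : EuclideanSpace ℝ (Fin n)) : ℝ :=
  1 / 2 * ∑ l, (g x)⁻¹ k l *
    (pd i (fun y => g y j l) x + pd j (fun y => g y i l) x - pd l (fun y => g y i j) x)

/-- The curvature tensor `Rˡₖᵢⱼ`, that is, `R(∂ᵢ, ∂ⱼ)∂ₖ = Rˡₖᵢⱼ ∂ₗ`. -/
def riemann (g : EuclideanSpace ℝ (Fin n) → Matrix (Fin n) (Fin n) ℝ) (l k i j : Fin n)
    (x : EuclideanSpace ℝ (Fin n)) : ℝ :=
  pd i (christoffel g l j k) x - pd j (christoffel g l i k) x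
    + ∑ m, (christoffel g l i m x * christoffel g m j k x
      - christoffel g l j m x * christoffel g m i k x)

/-- The curvature tensor with all indices lowered, `Rₗₖᵢⱼ`. -/
def riemannLower (g : EuclideanSpace ℝ (Fin n) → Matrix (Fin n) (Fin n) ℝ) (l k i j : Fin n)
    (x : EuclideanSpace ℝ (Fin n)) : ℝ :=
  ∑ m, g x l m * riemann g m k i j x

/-- The curvature tensor with all indices raised, `Rˡᵏⁱʲ`. -/
def riemannUpper (g : EuclideanSpace ℝ (Fin n) → Matrix (Fin n) (Fin n) ℝ) (l k i j : Fin n)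
    (x : EuclideanSpace ℝ (Fin n)) : ℝ :=
  ∑ k', ∑ i', ∑ j', (g x)⁻¹ k k' * (g x)⁻¹ i i' * (g x)⁻¹ j j' * riemann g l k' i' j' x

/-- The Ricci tensor `Rₖⱼ = Rˡₖₗⱼ`. -/
def ricci (g : EuclideanSpace ℝ (Fin n) → Matrix (Fin n) (Fin n) ℝ) (k j : Fin n)
    (x : EuclideanSpace ℝ (Fin n)) : ℝ :=
  ∑ l, riemann g l k l j x

/-- The scalar curvature. -/
def scalarCurvature (g : EuclideanSpace ℝ (Fin n) → Matrix (Fin n) (Fin n) ℝ)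
    (x : EuclideanSpace ℝ (Fin n)) : ℝ :=
  ∑ i, ∑ j, (g x)⁻¹ i j * ricci g i j x

/-- The Kretschmann scalar `Rˡᵏⁱʲ Rₗₖᵢⱼ`. -/
def kretschmann (g : EuclideanSpace ℝ (Fin n) → Matrix (Fin n) (Fin n) ℝ)
    (x : EuclideanSpace ℝ (Fin n)) : ℝ :=
  ∑ l, ∑ k, ∑ i, ∑ j, riemannUpper g l k i j x * riemannLower g l k i j x

/-- `g(∇u, ∇u)`. -/
def gradNormSq (g : EuclideanSpace ℝ (Fin n) → Matrix (Fin n) (Fin n) ℝ)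
    (u : EuclideanSpace ℝ (Fin n) → ℝ) (x : EuclideanSpace ℝ (Fin n)) : ℝ :=
  ∑ i, ∑ j, (g x)⁻¹ i j * pd i u x * pd j u x

/-- The wave operator `∇ᵘ∇ᵤ u`. -/
def waveOp (g : EuclideanSpace ℝ (Fin n) → Matrix (Fin n) (Fin n) ℝ)
    (u : EuclideanSpace ℝ (Fin n) → ℝ) (x : EuclideanSpace ℝ (Fin n)) : ℝ :=
  ∑ i, ∑ j, (g x)⁻¹ i j * (pd i (pd j u) x - ∑ k, christoffel g k i j x * pd k u x)

/-- The energy-momentum tensor `∂ᵢu ∂ⱼu - ½ gᵢⱼ g(∇u, ∇u)` of a massless scalar field `u`. -/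
def stressEnergy (g : EuclideanSpace ℝ (Fin n) → Matrix (Fin n) (Fin n) ℝ)
    (u : EuclideanSpace ℝ (Fin n) → ℝ) (i j : Fin n) (x : EuclideanSpace ℝ (Fin n)) : ℝ :=
  pd i u x * pd j u x - 1 / 2 * g x i j * gradNormSq g u x

/-- For a function `u` with timelike gradient (increasing to the future), the components of the
future-directed unit normal `-∇u / √(-g(∇u, ∇u))` to the level sets of `u`. -/
def unitNormal (g : EuclideanSpace ℝ (Fin n) → Matrix (Fin n) (Fin n) ℝ)
    (u : EuclideanSpace ℝ (Fin n) → ℝ) (i : Fin n) (x : EuclideanSpace ℝ (Fin n)) : ℝ :=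
  -(∑ j, (g x)⁻¹ i j * pd j u x) / √(-gradNormSq g u x)

/-- The mean curvature of the level set of `u` through `x`: the divergence of the future-directed
unit normal (positive when the level sets are expanding to the future). -/
def levelSetMeanCurvature (g : EuclideanSpace ℝ (Fin n) → Matrix (Fin n) (Fin n) ℝ)
    (u : EuclideanSpace ℝ (Fin n) → ℝ) (x : EuclideanSpace ℝ (Fin n)) : ℝ :=
  ∑ i, (pd i (unitNormal g u i) x + ∑ j, christoffel g i i j x * unitNormal g u j x)

end Coordinates

section Surface

variable {F : Type*} [TopologicalSpace F] [ChartedSpace (EuclideanSpace ℝ (Fin 2)) F]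
  [IsManifold (𝓡 2) ∞ F]

/-- Smooth Riemannian metrics on the surface `F`. -/
abbrev SurfaceMetric (F : Type*) [TopologicalSpace F]
    [ChartedSpace (EuclideanSpace ℝ (Fin 2)) F] [IsManifold (𝓡 2) ∞ F] :=
  Bundle.ContMDiffRiemannianMetric (𝓡 2) ∞ (EuclideanSpace ℝ (Fin 2))
    (fun p : F => TangentSpace (𝓡 2) p)

/-- The coordinate vector field `∂ᵢ` of the chart at `p`, at the point with coordinates `x`. -/
def coordVector (p : F) (i : Fin 2) (x : EuclideanSpace ℝ (Fin 2)) :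
    TangentSpace (𝓡 2) ((chartAt (EuclideanSpace ℝ (Fin 2)) p).symm x) :=
  mfderiv (𝓡 2) (𝓡 2) (chartAt (EuclideanSpace ℝ (Fin 2)) p).symm x
    (EuclideanSpace.single i (1 : ℝ) : EuclideanSpace ℝ (Fin 2))

/-- The components `σᵢⱼ = σ(∂ᵢ, ∂ⱼ)` of `σ` in the chart at `p`. -/
def SurfaceMetric.components (σ : SurfaceMetric F) (p : F) (x : EuclideanSpace ℝ (Fin 2)) :
    Matrix (Fin 2) (Fin 2) ℝ :=
  Matrix.of fun i j => σ.inner _ (coordVector p i x) (coordVector p j x)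

/-- The metric `σ` has constant (Gauss) curvature `ε`:
`Rₗₖᵢⱼ = ε (σₗᵢ σₖⱼ - σₗⱼ σₖᵢ)` at every point. -/
def HasConstantCurvature (σ : SurfaceMetric F) (ε : ℝ) : Prop :=
  ∀ p : F, ∀ l k i j : Fin 2,
    let x := chartAt (EuclideanSpace ℝ (Fin 2)) p p
    let γ := SurfaceMetric.components σ p
    riemannLower γ l k i j x = ε * (γ x l i * γ x k j - γ x l j * γ x k i)

end Surface

/-- The free data of a homogeneous spacetime `I × 𝕊¹ × F` with metric
`-dt² + a(t)² dz² + b(t)² σ` and scalar field `φ(t)`: an open time interval `I`, and twice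
continuously differentiable functions on it, with `a, b > 0`. -/
structure Homogeneous where
  I : Set ℝ
  a : ℝ → ℝ
  b : ℝ → ℝ
  φ : ℝ → ℝ
  isOpen : IsOpen I
  ordConnected : I.OrdConnected
  nonempty : I.Nonempty
  contDiffOn_a : ContDiffOn ℝ 2 a I
  contDiffOn_b : ContDiffOn ℝ 2 b I
  contDiffOn_φ : ContDiffOn ℝ 2 φ I
  a_pos : ∀ t ∈ I, 0 < a t
  b_pos : ∀ t ∈ I, 0 < b t

namespace Homogeneous

/-- `T` extends `S` to a possibly larger time interval. -/
def Extends (T S : Homogeneous) : Prop :=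
  S.I ⊆ T.I ∧ EqOn T.a S.a S.I ∧ EqOn T.b S.b S.I ∧ EqOn T.φ S.φ S.I

variable {F : Type*} [TopologicalSpace F] [ChartedSpace (EuclideanSpace ℝ (Fin 2)) F]
  [IsManifold (𝓡 2) ∞ F]

/-- The underlying manifold `I × 𝕊¹ × F`, as an open subset of `ℝ × 𝕊¹ × F`. -/
def carrier (S : Homogeneous) (F : Type*) : Set (ℝ × Circle × F) := {x | x.1 ∈ S.I}

/-- Local coordinates `(t, z, x¹, x²)` on `ℝ × 𝕊¹ × F` (the inverse of a coordinate chart):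
`z` is the angle on the circle and `(x¹, x²)` are the coordinates of the chart of `F` at `p`. -/
def param (p : F) (q : EuclideanSpace ℝ (Fin 4)) : ℝ × Circle × F :=
  (q 0, Circle.exp (q 1), (chartAt (EuclideanSpace ℝ (Fin 2)) p).symm !₂[q 2, q 3])

/-- The coordinates of the point `x = (t, z, p)` in the chart with inverse `param p`. -/
def coords (x : ℝ × Circle × F) : EuclideanSpace ℝ (Fin 4) :=
  !₂[x.1, Complex.arg x.2.1, chartAt (EuclideanSpace ℝ (Fin 2)) x.2.2 x.2.2 0,
    chartAt (EuclideanSpace ℝ (Fin 2)) x.2.2 x.2.2 1]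

/-- The components of the Lorentz metric `-dt² + a² dz² + b² σ` in the coordinates `param p`. -/
def metric (σ : SurfaceMetric F) (S : Homogeneous) (p : F) (q : EuclideanSpace ℝ (Fin 4)) :
    Matrix (Fin 4) (Fin 4) ℝ :=
  let γ := SurfaceMetric.components σ p !₂[q 2, q 3]
  !![-1, 0, 0, 0;
    0, S.a (q 0) ^ 2, 0, 0;
    0, 0, S.b (q 0) ^ 2 * γ 0 0, S.b (q 0) ^ 2 * γ 0 1;
    0, 0, S.b (q 0) ^ 2 * γ 1 0, S.b (q 0) ^ 2 * γ 1 1]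

/-- The scalar field as a function on spacetime. -/
def scalarField (S : Homogeneous) (F : Type*) (x : ℝ × Circle × F) : ℝ := S.φ x.1

/-- The Einstein-scalar field equations with cosmological constant `Λ`:
`Ric - ½ R g + Λ g = 8π T` and `∇ᵘ∇ᵤ φ = 0` at every point of spacetime. -/
def SolvesEinsteinScalar (σ : SurfaceMetric F) (Λ : ℝ) (S : Homogeneous) : Prop :=
  ∀ x ∈ S.carrier F,
    let g := S.metric σ x.2.2
    let u := S.scalarField F ∘ param x.2.2
    let q := coords x
    (∀ i j, ricci g i j q - 1 / 2 * scalarCurvature g q * g q i j + Λ * g q i j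
      = 8 * Real.pi * stressEnergy g u i j q) ∧
    waveOp g u q = 0

/-- A solution that cannot be extended, as a solution of this form, to a larger time interval. -/
def IsMaximalSolution (σ : SurfaceMetric F) (Λ : ℝ) (S : Homogeneous) : Prop :=
  S.SolvesEinsteinScalar σ Λ ∧
    ∀ T : Homogeneous, T.SolvesEinsteinScalar σ Λ → T.Extends S → T.I = S.I

/-- The Kretschmann scalar as a function on spacetime. -/
def kretschmannScalar (σ : SurfaceMetric F) (S : Homogeneous) (x : ℝ × Circle × F) : ℝ :=
  kretschmann (S.metric σ x.2.2) (coords x)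

/-- The mean curvature at `x` of the level set through `x` of the function `τ` on spacetime. -/
def leafMeanCurvature (σ : SurfaceMetric F) (S : Homogeneous) (τ : ℝ × Circle × F → ℝ)
    (x : ℝ × Circle × F) : ℝ :=
  levelSetMeanCurvature (S.metric σ x.2.2) (τ ∘ param x.2.2) (coords x)

/-- The level sets of `τ` are a foliation of spacetime by spacelike hypersurfaces each of which has
constant mean curvature. -/
structure IsCMCFoliation (σ : SurfaceMetric F) (S : Homogeneous) (τ : ℝ × Circle × F → ℝ) :
    Prop where
  smooth : ∀ x ∈ S.carrier F, ContDiffAt ℝ ∞ (τ ∘ param x.2.2) (coords x)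
  timelike : ∀ x ∈ S.carrier F, gradNormSq (S.metric σ x.2.2) (τ ∘ param x.2.2) (coords x) < 0
  constant : ∀ x ∈ S.carrier F, ∀ y ∈ S.carrier F, τ x = τ y →
    S.leafMeanCurvature σ τ x = S.leafMeanCurvature σ τ y

/-- `s ↦ (t(s), exp(iθ(s)), p(s))`, `s₀ < s < s₁`, is a continuously differentiable timelike curve
in spacetime parametrized by proper time. -/
structure IsProperTimeCurve (σ : SurfaceMetric F) (S : Homogeneous) (s₀ s₁ : ℝ)
    (t θ : ℝ → ℝ) (p : ℝ → F) : Prop where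
  mem : ∀ s ∈ Ioo s₀ s₁, t s ∈ S.I
  contDiffOn_t : ContDiffOn ℝ 1 t (Ioo s₀ s₁)
  contDiffOn_θ : ContDiffOn ℝ 1 θ (Ioo s₀ s₁)
  contMDiffOn_p : ContMDiffOn 𝓘(ℝ, ℝ) (𝓡 2) 1 p (Ioo s₀ s₁)
  unit_speed : ∀ s ∈ Ioo s₀ s₁,
    -(deriv t s) ^ 2 + S.a (t s) ^ 2 * deriv θ s ^ 2
      + S.b (t s) ^ 2 * σ.inner (p s) (mfderiv 𝓘(ℝ, ℝ) (𝓡 2) p s (1 : ℝ))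
          (mfderiv 𝓘(ℝ, ℝ) (𝓡 2) p s (1 : ℝ)) = -1

end Homogeneous

end Recollapse

end

/-! The curvature of -dt² + a² dz² + b² σ acts diagonally on coordinate planes, so the field
equations are equivalent to ordinary differential equations for a, b, φ
(`solvesEinsteinScalar_iff`). Write H = ȧ/a, K = ḃ/b, θ = H + 2K and V = ab²; θ is the mean
curvature of the slices.

Three facts drive the argument. Raychaudhuri's equation with the constraint gives θ' = Λ - 8πφ̇² -
H² - 2K² ≤ Λ - θ²/3, where ε has cancelled; since Λ < 0, arctan θ decreases at a definite rate and
the lifetime is finite (`IsFlow.length_le`). The quantities HV, KV, φ̇V have derivatives ΛV, ΛV -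
εa, 0, so a positive lower bound on V near the future end controls all variables and the solution
continues (`IsFlow.exists_limit`, `IsFlow.exists_extension`). Finally φ̇V is constant.

In a maximal solution V therefore has no positive lower bound near the future end. This forces θ →
-∞, then V → 0, and hence φ̇² → ∞. The Kretschmann scalar dominates a multiple of φ̇² up to a
constant (`le_kretschmannScalar`). Time reversal gives the past end. Along a proper-time curve
|dt/ds| ≥ 1, which bounds its length by the lifetime. -/

noncomputable section

namespace Recollapse

/-! ### Christoffel symbols of the warped metric. -/

section Warped

/-- The coordinates `(x¹, x²)` of the point with spacetime coordinates `(t, z, x¹, x²)`. -/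
def spatial (q : EuclideanSpace ℝ (Fin 4)) : EuclideanSpace ℝ (Fin 2) := !₂[q 2, q 3]

lemma spatial_add_smul_zero (q : EuclideanSpace ℝ (Fin 4)) (t : ℝ) :
    spatial (q + t • EuclideanSpace.single 0 1) = spatial q := by
  ext i; fin_cases i <;> simp [spatial]

lemma spatial_add_smul_one (q : EuclideanSpace ℝ (Fin 4)) (t : ℝ) :
    spatial (q + t • EuclideanSpace.single 1 1) = spatial q := by
  ext i; fin_cases i <;> simp [spatial]

lemma spatial_add_smul_two (q : EuclideanSpace ℝ (Fin 4)) (t : ℝ) :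
    spatial (q + t • EuclideanSpace.single 2 1) = spatial q + t • EuclideanSpace.single 0 1 := by
  ext i; fin_cases i <;> simp [spatial]

lemma spatial_add_smul_three (q : EuclideanSpace ℝ (Fin 4)) (t : ℝ) :
    spatial (q + t • EuclideanSpace.single 3 1) = spatial q + t • EuclideanSpace.single 1 1 := by
  ext i; fin_cases i <;> simp [spatial]

lemma continuous_spatial : Continuous spatial := by
  unfold spatial
  fun_prop

/-- Partial derivatives of a product of a function of time and a function on the surface. -/
lemma pd_mul_spatial (f : ℝ → ℝ) (h : EuclideanSpace ℝ (Fin 2) → ℝ) (m : Fin 4)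
    (q : EuclideanSpace ℝ (Fin 4)) :
    pd m (fun q => f (q 0) * h (spatial q)) q =
      ![deriv f (q 0) * h (spatial q), 0, f (q 0) * pd 0 h (spatial q),
        f (q 0) * pd 1 h (spatial q)] m := by
  fin_cases m
  · simp [pd, lineDeriv, spatial_add_smul_zero, deriv_comp_const_add]
  · simp [pd, lineDeriv, spatial_add_smul_one]
  · simp [pd, lineDeriv, spatial_add_smul_two]
  · simp [pd, lineDeriv, spatial_add_smul_three]

lemma pd_comp_time (f : ℝ → ℝ) (m : Fin 4) (q : EuclideanSpace ℝ (Fin 4)) :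
    pd m (fun q => f (q 0)) q = if m = 0 then deriv f (q 0) else 0 := by
  have := pd_mul_spatial f (fun _ => 1) m q
  simp only [mul_one] at this
  rw [this]
  fin_cases m <;> simp [pd, lineDeriv]

lemma pd_congr {n : ℕ} {f g : EuclideanSpace ℝ (Fin n) → ℝ} {x : EuclideanSpace ℝ (Fin n)}
    (h : f =ᶠ[𝓝 x] g) (i : Fin n) : pd i f x = pd i g x :=
  h.lineDeriv_eq

/-- The components of the metric `-dt² + a² dz² + b² γ`. -/
def warped (a b : ℝ → ℝ) (γ : EuclideanSpace ℝ (Fin 2) → Matrix (Fin 2) (Fin 2) ℝ)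
    (q : EuclideanSpace ℝ (Fin 4)) : Matrix (Fin 4) (Fin 4) ℝ :=
  !![-1, 0, 0, 0;
    0, a (q 0) ^ 2, 0, 0;
    0, 0, b (q 0) ^ 2 * γ (spatial q) 0 0, b (q 0) ^ 2 * γ (spatial q) 0 1;
    0, 0, b (q 0) ^ 2 * γ (spatial q) 1 0, b (q 0) ^ 2 * γ (spatial q) 1 1]

variable {a b : ℝ → ℝ} {γ : EuclideanSpace ℝ (Fin 2) → Matrix (Fin 2) (Fin 2) ℝ}
  {q : EuclideanSpace ℝ (Fin 4)}

/-- The blocks invert separately, so the inverse metric is again of warped form. -/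
lemma warped_mul_warped_inv (ha : a (q 0) ≠ 0) (hb : b (q 0) ≠ 0)
    (hγ : IsUnit (γ (spatial q)).det) :
    warped a b γ q * warped a⁻¹ b⁻¹ γ⁻¹ q = 1 := by
  have h := Matrix.mul_nonsing_inv _ hγ
  have h00 := congrFun₂ h 0 0
  have h01 := congrFun₂ h 0 1
  have h10 := congrFun₂ h 1 0
  have h11 := congrFun₂ h 1 1
  simp [Matrix.mul_apply, Fin.sum_univ_two] at h00 h01 h10 h11
  ext i j
  fin_cases i <;> fin_cases j <;>
    simp [warped, Matrix.mul_apply, Fin.sum_univ_four] <;> field_simp <;> assumption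

lemma warped_inv (ha : a (q 0) ≠ 0) (hb : b (q 0) ≠ 0) (hγ : IsUnit (γ (spatial q)).det) :
    (warped a b γ q)⁻¹ = warped a⁻¹ b⁻¹ γ⁻¹ q :=
  Matrix.inv_eq_right_inv (warped_mul_warped_inv ha hb hγ)

lemma pd_warped (hda : DifferentiableAt ℝ a (q 0)) (hdb : DifferentiableAt ℝ b (q 0))
    (i j l : Fin 4) :
    pd i (fun q => warped a b γ q j l) q =
      (![!![0, 0, 0, 0;
          0, 2 * a (q 0) * deriv a (q 0), 0, 0;
          0, 0, 2 * b (q 0) * deriv b (q 0) * γ (spatial q) 0 0,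
            2 * b (q 0) * deriv b (q 0) * γ (spatial q) 0 1;
          0, 0, 2 * b (q 0) * deriv b (q 0) * γ (spatial q) 1 0,
            2 * b (q 0) * deriv b (q 0) * γ (spatial q) 1 1],
        0,
        !![0, 0, 0, 0; 0, 0, 0, 0;
          0, 0, b (q 0) ^ 2 * pd 0 (fun y => γ y 0 0) (spatial q),
            b (q 0) ^ 2 * pd 0 (fun y => γ y 0 1) (spatial q);
          0, 0, b (q 0) ^ 2 * pd 0 (fun y => γ y 1 0) (spatial q),
            b (q 0) ^ 2 * pd 0 (fun y => γ y 1 1) (spatial q)],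
        !![0, 0, 0, 0; 0, 0, 0, 0;
          0, 0, b (q 0) ^ 2 * pd 1 (fun y => γ y 0 0) (spatial q),
            b (q 0) ^ 2 * pd 1 (fun y => γ y 0 1) (spatial q);
          0, 0, b (q 0) ^ 2 * pd 1 (fun y => γ y 1 0) (spatial q),
            b (q 0) ^ 2 * pd 1 (fun y => γ y 1 1) (spatial q)]] :
        Fin 4 → Matrix (Fin 4) (Fin 4) ℝ) i j l := by
  have hc : ∀ c : ℝ, pd i (fun _ : EuclideanSpace ℝ (Fin 4) => c) q = 0 := by
    intro c; simp [pd, lineDeriv]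
  have hA : pd i (fun q : EuclideanSpace ℝ (Fin 4) => a (q 0) ^ 2) q
      = if i = 0 then 2 * a (q 0) * deriv a (q 0) else 0 := by
    rw [pd_comp_time (fun t => a t ^ 2)]
    simp [deriv_fun_pow hda]
  have hB : ∀ h : EuclideanSpace ℝ (Fin 2) → ℝ,
      pd i (fun q : EuclideanSpace ℝ (Fin 4) => b (q 0) ^ 2 * h (spatial q)) q =
      ![2 * b (q 0) * deriv b (q 0) * h (spatial q), 0, b (q 0) ^ 2 * pd 0 h (spatial q),
        b (q 0) ^ 2 * pd 1 h (spatial q)] i := by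
    intro h
    rw [pd_mul_spatial (fun t => b t ^ 2)]
    simp [deriv_fun_pow hdb]
  fin_cases j <;> fin_cases l <;>
    simp only [warped, Fin.zero_eta, Fin.mk_one, Fin.reduceFinMk, Matrix.of_apply,
      Matrix.cons_val', Matrix.cons_val, Fin.isValue, hc, hA] <;>
    first
      | (rw [hB (fun y => γ y _ _)]; fin_cases i <;> simp)
      | (fin_cases i <;> simp)

/-- The time-dependent factors of the Christoffel symbols of `-dt² + a² dz² + b² γ`. -/
def christoffelTime (a b : ℝ → ℝ) : Fin 4 → Matrix (Fin 4) (Fin 4) (ℝ → ℝ) :=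
  let A := fun t => a t * deriv a t
  let B := fun t => b t * deriv b t
  let H := fun t => deriv a t / a t
  let K := fun t => deriv b t / b t
  let o := fun _ => 1
  ![!![0, 0, 0, 0; 0, A, 0, 0; 0, 0, B, B; 0, 0, B, B],
    !![0, H, 0, 0; H, 0, 0, 0; 0, 0, 0, 0; 0, 0, 0, 0],
    !![0, 0, K, 0; 0, 0, 0, 0; K, 0, o, o; 0, 0, o, o],
    !![0, 0, 0, K; 0, 0, 0, 0; 0, 0, o, o; K, 0, o, o]]

/-- The factors on the surface of the Christoffel symbols of `-dt² + a² dz² + b² γ`. -/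
def christoffelSpace (γ : EuclideanSpace ℝ (Fin 2) → Matrix (Fin 2) (Fin 2) ℝ) :
    Fin 4 → Matrix (Fin 4) (Fin 4) (EuclideanSpace ℝ (Fin 2) → ℝ) :=
  let g := fun i j y => γ y i j
  let G := christoffel γ
  let o := fun _ => 1
  ![!![0, 0, 0, 0; 0, o, 0, 0; 0, 0, g 0 0, g 0 1; 0, 0, g 1 0, g 1 1],
    !![0, o, 0, 0; o, 0, 0, 0; 0, 0, 0, 0; 0, 0, 0, 0],
    !![0, 0, o, 0; 0, 0, 0, 0; o, 0, G 0 0 0, G 0 0 1; 0, 0, G 0 1 0, G 0 1 1],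
    !![0, 0, 0, o; 0, 0, 0, 0; 0, 0, G 1 0 0, G 1 0 1; o, 0, G 1 1 0, G 1 1 1]]

/-- The factorised form lets `pd_mul_spatial` differentiate the symbols once more when the curvature
is computed. -/
lemma christoffel_warped (ha : a (q 0) ≠ 0) (hb : b (q 0) ≠ 0)
    (hda : DifferentiableAt ℝ a (q 0)) (hdb : DifferentiableAt ℝ b (q 0))
    (hs : ∀ y, (γ y).IsSymm) (hγ : IsUnit (γ (spatial q)).det) (k i j : Fin 4) :
    christoffel (warped a b γ) k i j q =
      christoffelTime a b k i j (q 0) * christoffelSpace γ k i j (spatial q) := by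
  have h := Matrix.nonsing_inv_mul _ hγ
  have h00 := congrFun₂ h 0 0
  have h01 := congrFun₂ h 0 1
  have h10 := congrFun₂ h 1 0
  have h11 := congrFun₂ h 1 1
  have hs' : γ (spatial q) 1 0 = γ (spatial q) 0 1 := (hs _).apply 0 1
  simp [Matrix.mul_apply, Fin.sum_univ_two, hs'] at h00 h01 h10 h11
  simp only [christoffel, warped_inv ha hb hγ, pd_warped hda hdb, Fin.sum_univ_four]
  -- The symbols with one time index and two surface indices reduce to ḃ/b times entries of γ⁻¹γ =
  -- 1.
  fin_cases k <;> fin_cases i <;> fin_cases j <;>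
    simp [christoffelTime, christoffelSpace, warped, christoffel, Fin.sum_univ_two, hs'] <;>
    field_simp <;>
    first
      | assumption
      | linear_combination deriv b (q 0) * h00
      | linear_combination deriv b (q 0) * h11
      | linear_combination 2 * deriv b (q 0) * h01
      | linear_combination 2 * deriv b (q 0) * h10

end Warped

/-! ### Curvature and Ricci tensors of the warped metric. -/

section Warped

variable {a b : ℝ → ℝ} {γ : EuclideanSpace ℝ (Fin 2) → Matrix (Fin 2) (Fin 2) ℝ}
  {q : EuclideanSpace ℝ (Fin 4)}

lemma riemann_swap {n : ℕ} (g : EuclideanSpace ℝ (Fin n) → Matrix (Fin n) (Fin n) ℝ)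
    (l k i j : Fin n) (x : EuclideanSpace ℝ (Fin n)) :
    riemann g l k j i x = -riemann g l k i j x := by
  simp only [riemann, Finset.sum_sub_distrib]
  ring

lemma christoffel_comm {n : ℕ} {g : EuclideanSpace ℝ (Fin n) → Matrix (Fin n) (Fin n) ℝ}
    (hg : ∀ y, (g y).IsSymm) (k i j : Fin n) (x : EuclideanSpace ℝ (Fin n)) :
    christoffel g k i j x = christoffel g k j i x := by
  have : ∀ y, g y i j = g y j i := fun y => (hg y).apply j i
  simp only [christoffel, this]
  congr 1
  exact Finset.sum_congr rfl fun l _ => by ring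

/-- Compatibility of the Levi-Civita connection with the metric. -/
lemma sum_mul_christoffel {n : ℕ} {g : EuclideanSpace ℝ (Fin n) → Matrix (Fin n) (Fin n) ℝ}
    {x : EuclideanSpace ℝ (Fin n)} (hg : IsUnit (g x).det) (k i j : Fin n) :
    ∑ m, g x k m * christoffel g m i j x =
      1 / 2 * (pd i (fun y => g y j k) x + pd j (fun y => g y i k) x
        - pd k (fun y => g y i j) x) := by
  have h : ∀ l, ∑ m, g x k m * (g x)⁻¹ m l = if k = l then 1 else 0 := fun l => by
    have := congrFun₂ (Matrix.mul_nonsing_inv _ hg) k l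
    rwa [Matrix.mul_apply, Matrix.one_apply] at this
  simp only [christoffel, Finset.mul_sum]
  rw [Finset.sum_comm]
  calc _ = ∑ l, (∑ m, g x k m * (g x)⁻¹ m l) * (1 / 2 * (pd i (fun y => g y j l) x
        + pd j (fun y => g y i l) x - pd l (fun y => g y i j) x)) := by
        refine Finset.sum_congr rfl fun l _ => ?_
        rw [Finset.sum_mul]
        exact Finset.sum_congr rfl fun m _ => by ring
    _ = _ := by simp [h]

/-- The Kretschmann scalar of a metric whose curvature tensor is diagonal on coordinate planes. -/
lemma kretschmann_of_riemann_eq {n : ℕ}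
    {g : EuclideanSpace ℝ (Fin n) → Matrix (Fin n) (Fin n) ℝ} {x : EuclideanSpace ℝ (Fin n)}
    (hg : IsUnit (g x).det) (hs : (g x).IsSymm) {c : Matrix (Fin n) (Fin n) ℝ}
    (hcs : c.IsSymm) (hcg : ∀ l i j, c l i * g x i j = c l j * g x i j)
    (hc : ∀ l i j, c l i * (g x)⁻¹ i j = c l j * (g x)⁻¹ i j)
    (hR : ∀ l k i j, riemann g l k i j x =
      c l k * ((if l = i then 1 else 0) * g x k j - (if l = j then 1 else 0) * g x k i)) :
    kretschmann g x = 2 * (∑ l, ∑ k, c l k ^ 2 - ∑ l, c l l ^ 2) := by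
  have hgi : ∀ i j, ∑ m, (g x)⁻¹ i m * g x m j = if i = j then 1 else 0 := fun i j => by
    have := congrFun₂ (Matrix.nonsing_inv_mul _ hg) i j
    rwa [Matrix.mul_apply, Matrix.one_apply] at this
  have hsi : ∀ i j, (g x)⁻¹ i j = (g x)⁻¹ j i := fun i j => hs.inv.apply j i
  have hsg : ∀ i j, g x i j = g x j i := fun i j => hs.apply j i
  have hup : ∀ l k i j, riemannUpper g l k i j x =
      c l k * ((g x)⁻¹ l i * (g x)⁻¹ k j - (g x)⁻¹ l j * (g x)⁻¹ k i) := fun l k i j => by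
    calc riemannUpper g l k i j x
        = ∑ k', c l k' * (g x)⁻¹ k k' * ((g x)⁻¹ i l * (∑ j', (g x)⁻¹ j j' * g x j' k')
            - (g x)⁻¹ j l * (∑ i', (g x)⁻¹ i i' * g x i' k')) := by
          simp only [riemannUpper, hR]
          refine Finset.sum_congr rfl fun k' _ => ?_
          simp only [mul_sub, Finset.sum_sub_distrib, Finset.mul_sum]
          congr 1
          · rw [Finset.sum_comm]
            refine Finset.sum_congr rfl fun j' _ => ?_
            rw [Finset.sum_eq_single l (by intro b _ hb; simp [hb.symm]) (by simp), hsg j' k']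
            simp only [if_true]
            ring
          · refine Finset.sum_congr rfl fun i' _ => ?_
            rw [Finset.sum_eq_single l (by intro b _ hb; simp [hb.symm]) (by simp), hsg i' k']
            simp only [if_true]
            ring
      _ = c l j * (g x)⁻¹ k j * (g x)⁻¹ i l - c l i * (g x)⁻¹ k i * (g x)⁻¹ j l := by
          simp [hgi, mul_sub, Finset.sum_sub_distrib]
      _ = _ := by
          -- `hc` says that c is constant along indices linked by the inverse metric, so both
          -- coefficients become c l k.
          rw [← hc, ← hc, hsi i l, hsi j l]
          ring
  have hlow : ∀ l k i j, riemannLower g l k i j x =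
      c l k * (g x l i * g x k j - g x l j * g x k i) := fun l k i j => by
    have hm : ∀ m, g x l m * c m k = c l k * g x l m := fun m => by
      rw [hcs.apply k m, hcs.apply k l, hcg k l m, mul_comm]
    simp only [riemannLower, hR, ← mul_assoc, hm]
    simp [mul_sub, Finset.sum_sub_distrib, mul_assoc]
  have h1 : ∀ i j, ∑ m, (g x)⁻¹ i m * g x j m = if i = j then 1 else 0 := fun i j => by
    rw [← hgi]
    exact Finset.sum_congr rfl fun m _ => by rw [hsg j m]
  -- Of the four full contractions, the first two are always 1 and the last two are 1 only for l =
  -- k; diagonal pairs therefore cancel.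
  have hlk : ∀ l k, ∑ i, ∑ j, riemannUpper g l k i j x * riemannLower g l k i j x =
      2 * (c l k ^ 2 - if l = k then c l k ^ 2 else 0) := fun l k => by
    calc _ = c l k ^ 2 * ((∑ i, (g x)⁻¹ l i * g x l i) * (∑ j, (g x)⁻¹ k j * g x k j)
          + (∑ i, (g x)⁻¹ k i * g x k i) * (∑ j, (g x)⁻¹ l j * g x l j)
          - (∑ i, (g x)⁻¹ l i * g x k i) * (∑ j, (g x)⁻¹ k j * g x l j)
          - (∑ i, (g x)⁻¹ k i * g x l i) * (∑ j, (g x)⁻¹ l j * g x k j)) := by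
          simp only [Finset.sum_mul_sum]
          simp only [← Finset.sum_add_distrib, ← Finset.sum_sub_distrib,
            Finset.mul_sum, hup, hlow]
          exact Finset.sum_congr rfl fun i _ => Finset.sum_congr rfl fun j _ => by ring
      _ = _ := by
          simp only [h1]
          rcases eq_or_ne l k with rfl | hne
          · simp
          · simp [hne, hne.symm]
            ring
  simp only [kretschmann, hlk, ← Finset.mul_sum, Finset.sum_sub_distrib]
  simp

/-- The sectional curvatures of `-dt² + a² dz² + b² σ` on the coordinate planes,
where `σ` has curvature `ε`. -/
def sectional (ε : ℝ) (a b : ℝ → ℝ) (t : ℝ) : Matrix (Fin 4) (Fin 4) ℝ :=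
  let α := deriv (deriv a) t / a t
  let β := deriv (deriv b) t / b t
  let μ := deriv a t / a t * (deriv b t / b t)
  let ν := (deriv b t / b t) ^ 2 + ε / b t ^ 2
  !![0, α, β, β; α, 0, μ, μ; β, μ, ν, ν; β, μ, ν, ν]

/-- Regularity of the metric `-dt² + a² dz² + b² γ` near the point with coordinates `q`. -/
structure RegularAt (a b : ℝ → ℝ) (γ : EuclideanSpace ℝ (Fin 2) → Matrix (Fin 2) (Fin 2) ℝ)
    (q : EuclideanSpace ℝ (Fin 4)) : Prop where
  contDiffAt_a : ContDiffAt ℝ 2 a (q 0)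
  contDiffAt_b : ContDiffAt ℝ 2 b (q 0)
  a_ne : a (q 0) ≠ 0
  b_ne : b (q 0) ≠ 0
  symm : ∀ y, (γ y).IsSymm
  det : ∀ᶠ y in 𝓝 (spatial q), IsUnit (γ y).det

lemma eventually_differentiableAt {f : ℝ → ℝ} {t : ℝ} (hf : ContDiffAt ℝ 2 f t) :
    ∀ᶠ s in 𝓝 t, DifferentiableAt ℝ f s := by
  filter_upwards [hf.eventually (by simp)] with s hs using hs.differentiableAt (by simp)

lemma differentiableAt_deriv {f : ℝ → ℝ} {t : ℝ} (hf : ContDiffAt ℝ 2 f t) :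
    DifferentiableAt ℝ (deriv f) t := by
  have : ContDiffAt ℝ 1 (deriv f) t := by
    exact hf.derivWithin (m := 1) (by norm_num)
  exact this.differentiableAt (by simp)

lemma tendsto_time (q : EuclideanSpace ℝ (Fin 4)) :
    Tendsto (fun q : EuclideanSpace ℝ (Fin 4) => q 0) (𝓝 q) (𝓝 (q 0)) :=
  Continuous.tendsto (by fun_prop) q

namespace RegularAt

lemma isUnit_det (h : RegularAt a b γ q) : IsUnit (γ (spatial q)).det := h.det.self_of_nhds

lemma eventually_warped_inv (h : RegularAt a b γ q) :
    ∀ᶠ q' in 𝓝 q, (warped a b γ q')⁻¹ = warped a⁻¹ b⁻¹ γ⁻¹ q' := by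
  filter_upwards [(tendsto_time q).eventually (h.contDiffAt_a.continuousAt.eventually_ne h.a_ne),
    (tendsto_time q).eventually (h.contDiffAt_b.continuousAt.eventually_ne h.b_ne),
    (continuous_spatial.tendsto q).eventually h.det] with q' h1 h2 h3
  exact warped_inv h1 h2 h3

/-- The formula is needed on a neighbourhood because curvature differentiates the symbols. -/
lemma eventually_christoffel (h : RegularAt a b γ q) :
    ∀ᶠ q' in 𝓝 q, ∀ k i j, christoffel (warped a b γ) k i j q' =
      christoffelTime a b k i j (q' 0) * christoffelSpace γ k i j (spatial q') := by
  filter_upwards [(tendsto_time q).eventually (h.contDiffAt_a.continuousAt.eventually_ne h.a_ne),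
    (tendsto_time q).eventually (h.contDiffAt_b.continuousAt.eventually_ne h.b_ne),
    (tendsto_time q).eventually (eventually_differentiableAt h.contDiffAt_a),
    (tendsto_time q).eventually (eventually_differentiableAt h.contDiffAt_b),
    (continuous_spatial.tendsto q).eventually h.det] with q' h1 h2 h3 h4 h5
  exact christoffel_warped h1 h2 h3 h4 h.symm h5

lemma pd_christoffel (h : RegularAt a b γ q) (m k i j : Fin 4) :
    pd m (christoffel (warped a b γ) k i j) q =
      ![deriv (christoffelTime a b k i j) (q 0) * christoffelSpace γ k i j (spatial q), 0,
        christoffelTime a b k i j (q 0) * pd 0 (christoffelSpace γ k i j) (spatial q),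
        christoffelTime a b k i j (q 0) * pd 1 (christoffelSpace γ k i j) (spatial q)] m := by
  rw [pd_congr (h.eventually_christoffel.mono fun q' hq => hq k i j), pd_mul_spatial]

-- The curvature of the surface enters only when all four indices lie on it, where the warping adds
-- ḃ² to it. The other components come from derivatives of the warping factors or vanish.
set_option maxHeartbeats 4000000 in
lemma riemann_warped (h : RegularAt a b γ q) {ε : ℝ}
    (hR : ∀ l k i j, riemann γ l k i j (spatial q) =
      ε * ((if l = i then 1 else 0) * γ (spatial q) k j
        - (if l = j then 1 else 0) * γ (spatial q) k i))
    (l k i j : Fin 4) :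
    riemann (warped a b γ) l k i j q = sectional ε a b (q 0) l k *
      ((if l = i then 1 else 0) * warped a b γ q k j
        - (if l = j then 1 else 0) * warped a b γ q k i) := by
  -- Antisymmetry in the last two indices leaves six pairs.
  wlog hij : i < j generalizing i j
  · rcases eq_or_lt_of_le (not_lt.1 hij) with rfl | hji
    · have := riemann_swap (warped a b γ) l k j j q
      rw [show riemann (warped a b γ) l k j j q = 0 by linarith]
      ring
    · rw [riemann_swap, this j i hji]
      ring
  have ha := h.a_ne
  have hb := h.b_ne
  have hda := h.contDiffAt_a.differentiableAt (by simp)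
  have hdb := h.contDiffAt_b.differentiableAt (by simp)
  have hdda := differentiableAt_deriv h.contDiffAt_a
  have hddb := differentiableAt_deriv h.contDiffAt_b
  have dA : deriv (fun t => a t * deriv a t) (q 0) =
      deriv a (q 0) * deriv a (q 0) + a (q 0) * deriv (deriv a) (q 0) := deriv_fun_mul hda hdda
  have dB : deriv (fun t => b t * deriv b t) (q 0) =
      deriv b (q 0) * deriv b (q 0) + b (q 0) * deriv (deriv b) (q 0) := deriv_fun_mul hdb hddb
  have dH : deriv (fun t => deriv a t / a t) (q 0) =
      (deriv (deriv a) (q 0) * a (q 0) - deriv a (q 0) * deriv a (q 0)) / a (q 0) ^ 2 :=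
    deriv_fun_div hdda hda ha
  have dK : deriv (fun t => deriv b t / b t) (q 0) =
      (deriv (deriv b) (q 0) * b (q 0) - deriv b (q 0) * deriv b (q 0)) / b (q 0) ^ 2 :=
    deriv_fun_div hddb hdb hb
  have hs : ∀ y, γ y 1 0 = γ y 0 1 := fun y => (h.symm y).apply 0 1
  have p1 : ∀ m, pd m (fun _ : EuclideanSpace ℝ (Fin 2) => (1 : ℝ)) (spatial q) = 0 := by
    intro m; simp [pd, lineDeriv]
  have p0 : ∀ m, pd m (0 : EuclideanSpace ℝ (Fin 2) → ℝ) (spatial q) = 0 := by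
    intro m; simp [pd, lineDeriv]
  -- Compatibility of the surface connection with γ makes the components with l = 0 and i, j on the
  -- surface vanish.
  have hG : ∀ k i j, γ (spatial q) k 0 * christoffel γ 0 i j (spatial q) +
      γ (spatial q) k 1 * christoffel γ 1 i j (spatial q) = 1 / 2 *
      (pd i (fun y => γ y j k) (spatial q) + pd j (fun y => γ y i k) (spatial q)
        - pd k (fun y => γ y i j) (spatial q)) := fun k i j => by
    rw [← sum_mul_christoffel h.isUnit_det, Fin.sum_univ_two]
  have g1 := hG 1 0 0
  have g2 := hG 0 1 0
  have g3 := hG 1 0 1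
  have g4 := hG 0 1 1
  have hΓ : ∀ k, christoffel γ k 1 0 (spatial q) = christoffel γ k 0 1 (spatial q) :=
    fun k => christoffel_comm h.symm k 1 0 _
  have e1 : ∀ x, deriv b (q 0) / b (q 0) * (b (q 0) * deriv b (q 0) * x) =
      deriv b (q 0) ^ 2 * x := fun x => by field_simp
  have e2 : ∀ x, ((deriv b (q 0) / b (q 0)) ^ 2 + ε / b (q 0) ^ 2) * (b (q 0) ^ 2 * x) =
      deriv b (q 0) ^ 2 * x + ε * x := fun x => by field_simp
  have r00 := hR 0 0 0 1
  have r01 := hR 0 1 0 1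
  have r10 := hR 1 0 0 1
  have r11 := hR 1 1 0 1
  simp only [riemann, Fin.sum_univ_two, hs, hΓ] at r00 r01 r10 r11 g1 g2 g3 g4
  simp at r00 r01 r10 r11
  simp only [riemann, h.pd_christoffel, h.eventually_christoffel.self_of_nhds,
    Fin.sum_univ_four]
  fin_cases i <;> fin_cases j <;> first | exact absurd hij (by decide) | skip
  all_goals
    fin_cases l <;> fin_cases k <;>
      simp [christoffelTime, christoffelSpace, warped, sectional, hs, dA, dB, dH, dK, p0, p1]
  all_goals try (field_simp; done)
  all_goals try (field_simp; ring1)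
  all_goals try simp only [e1, e2, hΓ]
  · linear_combination b (q 0) * deriv b (q 0) * (g2 - g1)
  · linear_combination b (q 0) * deriv b (q 0) * (g4 - g3)
  · ring
  · linear_combination r00
  · linear_combination r01
  · ring
  · linear_combination r10
  · linear_combination r11

/-- The contraction subtracts the (j, k) coefficient; wherever the metric entry is nonzero it equals
the (k, k) one. -/
lemma ricci_warped (h : RegularAt a b γ q) {ε : ℝ}
    (hR : ∀ l k i j, riemann γ l k i j (spatial q) =
      ε * ((if l = i then 1 else 0) * γ (spatial q) k j
        - (if l = j then 1 else 0) * γ (spatial q) k i))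
    (k j : Fin 4) :
    ricci (warped a b γ) k j q =
      (∑ l, sectional ε a b (q 0) l k - sectional ε a b (q 0) k k) * warped a b γ q k j := by
  simp only [ricci, h.riemann_warped hR, Fin.sum_univ_four]
  fin_cases k <;> fin_cases j <;> simp [warped, sectional] <;> ring

end RegularAt
end Warped

/-! ### Kretschmann scalar, matter terms and mean curvature of the warped metric. -/

section Warped

variable {a b : ℝ → ℝ} {γ : EuclideanSpace ℝ (Fin 2) → Matrix (Fin 2) (Fin 2) ℝ}
  {q : EuclideanSpace ℝ (Fin 4)}

namespace RegularAt

lemma isSymm_warped (h : RegularAt a b γ q) : (warped a b γ q).IsSymm := by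
  have hs : γ (spatial q) 1 0 = γ (spatial q) 0 1 := (h.symm _).apply 0 1
  ext i j
  fin_cases i <;> fin_cases j <;> simp [warped, hs]

lemma isUnit_det_warped (h : RegularAt a b γ q) : IsUnit (warped a b γ q).det := by
  rw [← Matrix.isUnit_iff_isUnit_det]
  exact IsUnit.of_mul_eq_one _ (warped_mul_warped_inv h.a_ne h.b_ne h.isUnit_det)

lemma kretschmann_warped (h : RegularAt a b γ q) {ε : ℝ}
    (hR : ∀ l k i j, riemann γ l k i j (spatial q) =
      ε * ((if l = i then 1 else 0) * γ (spatial q) k j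
        - (if l = j then 1 else 0) * γ (spatial q) k i)) :
    kretschmann (warped a b γ) q =
      4 * (sectional ε a b (q 0) 0 1 ^ 2 + 2 * sectional ε a b (q 0) 0 2 ^ 2
        + 2 * sectional ε a b (q 0) 1 2 ^ 2 + sectional ε a b (q 0) 2 3 ^ 2) := by
  rw [kretschmann_of_riemann_eq h.isUnit_det_warped h.isSymm_warped ?_ ?_ ?_
    (h.riemann_warped hR)]
  · simp [Fin.sum_univ_four, sectional]
    ring
  · ext i j
    fin_cases i <;> fin_cases j <;> simp [sectional]
  · intro l i j
    fin_cases l <;> fin_cases i <;> fin_cases j <;> simp [sectional, warped]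
  · intro l i j
    rw [h.eventually_warped_inv.self_of_nhds]
    fin_cases l <;> fin_cases i <;> fin_cases j <;> simp [sectional, warped]

lemma gradNormSq_warped (h : RegularAt a b γ q) (f : ℝ → ℝ) :
    gradNormSq (warped a b γ) (fun q => f (q 0)) q = -deriv f (q 0) ^ 2 := by
  simp only [gradNormSq, h.eventually_warped_inv.self_of_nhds, pd_comp_time, Fin.sum_univ_four]
  simp [warped, sq]

lemma stressEnergy_warped (h : RegularAt a b γ q) (f : ℝ → ℝ) (i j : Fin 4) :
    stressEnergy (warped a b γ) (fun q => f (q 0)) i j q =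
      (if i = 0 ∧ j = 0 then deriv f (q 0) ^ 2 else 0)
        + 1 / 2 * warped a b γ q i j * deriv f (q 0) ^ 2 := by
  simp only [stressEnergy, h.gradNormSq_warped, pd_comp_time]
  by_cases hi : i = 0 <;> by_cases hj : j = 0 <;> (simp [hi, hj]; try ring)

lemma scalarCurvature_warped (h : RegularAt a b γ q) {ε : ℝ}
    (hR : ∀ l k i j, riemann γ l k i j (spatial q) =
      ε * ((if l = i then 1 else 0) * γ (spatial q) k j
        - (if l = j then 1 else 0) * γ (spatial q) k i)) :
    scalarCurvature (warped a b γ) q = ∑ k, (∑ l, sectional ε a b (q 0) l k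
      - sectional ε a b (q 0) k k) := by
  have hg : ∀ k, ∑ j, (warped a b γ q)⁻¹ k j * warped a b γ q k j = 1 := fun k => by
    have := congrFun₂ (Matrix.nonsing_inv_mul _ h.isUnit_det_warped) k k
    rw [Matrix.mul_apply, Matrix.one_apply_eq] at this
    rw [← this]
    exact Finset.sum_congr rfl fun j _ => by rw [h.isSymm_warped.apply j k]
  simp only [scalarCurvature, h.ricci_warped hR]
  refine Finset.sum_congr rfl fun k _ => ?_
  calc _ = (∑ l, sectional ε a b (q 0) l k - sectional ε a b (q 0) k k)
        * ∑ j, (warped a b γ q)⁻¹ k j * warped a b γ q k j := by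
        rw [Finset.mul_sum]
        exact Finset.sum_congr rfl fun j _ => by ring
    _ = _ := by rw [hg, mul_one]

lemma waveOp_warped (h : RegularAt a b γ q) (f : ℝ → ℝ) :
    waveOp (warped a b γ) (fun q => f (q 0)) q =
      -(deriv (deriv f) (q 0)
        + (deriv a (q 0) / a (q 0) + 2 * (deriv b (q 0) / b (q 0))) * deriv f (q 0)) := by
  have ha := h.a_ne
  have hb := h.b_ne
  have hpd : ∀ j, pd j (fun q : EuclideanSpace ℝ (Fin 4) => f (q 0)) =
      fun q => (if j = 0 then deriv f else 0) (q 0) := fun j => by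
    ext q'
    rw [pd_comp_time]
    split_ifs <;> rfl
  have hdd : ∀ i j : Fin 4, pd i (fun q : EuclideanSpace ℝ (Fin 4) =>
      (if j = 0 then deriv f else 0) (q 0)) q =
        if i = 0 then deriv (if j = 0 then deriv f else 0) (q 0) else 0 := fun i j =>
    pd_comp_time _ _ _
  have h' := Matrix.nonsing_inv_mul _ h.isUnit_det
  have h00 := congrFun₂ h' 0 0
  have h11 := congrFun₂ h' 1 1
  have hs : γ (spatial q) 1 0 = γ (spatial q) 0 1 := (h.symm _).apply 0 1
  simp [Matrix.mul_apply, Fin.sum_univ_two, hs] at h00 h11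
  simp only [waveOp, hpd, hdd, h.eventually_warped_inv.self_of_nhds,
    h.eventually_christoffel.self_of_nhds, Fin.sum_univ_four]
  simp [warped, christoffelTime, christoffelSpace, hs]
  field_simp
  -- The sum `h00 + h11` is the trace of γ⁻¹γ = 1, the source of the factor 2 in front of ḃ/b.
  linear_combination -(a (q 0) * deriv f (q 0) * deriv b (q 0)) * (h00 + h11)

/-- The unit normal is ∂ₜ on a whole neighbourhood, so its components have zero derivative and only
the trace of Γⁱᵢ₀ remains. -/
lemma levelSetMeanCurvature_warped (h : RegularAt a b γ q)
    (h' : ∀ᶠ q' in 𝓝 q, RegularAt a b γ q') :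
    levelSetMeanCurvature (warped a b γ) (fun q => q 0) q =
      deriv a (q 0) / a (q 0) + 2 * (deriv b (q 0) / b (q 0)) := by
  have hn : ∀ i, unitNormal (warped a b γ) (fun q => q 0) i =ᶠ[𝓝 q]
      fun _ => if i = 0 then 1 else 0 := fun i => by
    filter_upwards [h'] with q' hq'
    have hg := hq'.gradNormSq_warped (fun t => t)
    have hp := fun j => pd_comp_time (fun t => t) j q'
    simp only [unitNormal, hg, hp, hq'.eventually_warped_inv.self_of_nhds]
    fin_cases i <;> simp [warped]
  have hc : ∀ i (c : ℝ), pd i (fun _ : EuclideanSpace ℝ (Fin 4) => c) q = 0 := by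
    intro i c; simp [pd, lineDeriv]
  simp only [levelSetMeanCurvature, pd_congr (hn _), (hn _).self_of_nhds, hc,
    h.eventually_christoffel.self_of_nhds, Fin.sum_univ_four]
  simp [christoffelTime, christoffelSpace]
  ring

end RegularAt
end Warped

/-! ### The surface metric in charts. -/

section Surface

variable {F : Type*} [TopologicalSpace F] [ChartedSpace (EuclideanSpace ℝ (Fin 2)) F]
  [IsManifold (𝓡 2) ∞ F]

lemma components_isSymm (σ : SurfaceMetric F) (p : F) (y : EuclideanSpace ℝ (Fin 2)) :
    (SurfaceMetric.components σ p y).IsSymm := by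
  ext i j
  exact σ.symm _ _ _

lemma injective_mfderiv_chart_symm (p : F) {y : EuclideanSpace ℝ (Fin 2)}
    (hy : y ∈ (chartAt (EuclideanSpace ℝ (Fin 2)) p).target) :
    Function.Injective
      (mfderiv (𝓡 2) (𝓡 2) (chartAt (EuclideanSpace ℝ (Fin 2)) p).symm y) := by
  have he : (chartAt (EuclideanSpace ℝ (Fin 2)) p).MDifferentiable (𝓡 2) (𝓡 2) :=
    mdifferentiable_chart p
  exact he.symm.mfderiv_injective hy

/-- The inverse chart has injective derivative on its target, so the coordinate vectors are linearly
independent there. -/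
lemma components_posDef (σ : SurfaceMetric F) (p : F) {y : EuclideanSpace ℝ (Fin 2)}
    (hy : y ∈ (chartAt (EuclideanSpace ℝ (Fin 2)) p).target) :
    (SurfaceMetric.components σ p y).PosDef := by
  refine Matrix.PosDef.of_dotProduct_mulVec_pos ?_ ?_
  · ext i j
    exact σ.symm _ _ _
  · intro v hv
    have hne : v 0 • coordVector p 0 y + v 1 • coordVector p 1 y ≠ 0 := by
      intro h
      refine hv ?_
      have hL : mfderiv (𝓡 2) (𝓡 2) (chartAt (EuclideanSpace ℝ (Fin 2)) p).symm y
          (v 0 • EuclideanSpace.single 0 1 + v 1 • EuclideanSpace.single 1 1 :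
            EuclideanSpace ℝ (Fin 2)) = 0 := by
        refine Eq.trans ?_ h
        refine (map_add _ _ _).trans ?_
        congr 1 <;> exact map_smul _ _ _
      have h0 : (v 0 • EuclideanSpace.single 0 1 + v 1 • EuclideanSpace.single 1 1 :
          EuclideanSpace ℝ (Fin 2)) = 0 := injective_mfderiv_chart_symm p hy (hL.trans (map_zero _).symm)
      ext i
      have := congrFun (congrArg WithLp.ofLp h0) i
      fin_cases i
      · simpa using this
      · simpa using this
    have := σ.pos _ _ hne
    have hsum : star v ⬝ᵥ (SurfaceMetric.components σ p y).mulVec v =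
        σ.inner _ (v 0 • coordVector p 0 y + v 1 • coordVector p 1 y)
          (v 0 • coordVector p 0 y + v 1 • coordVector p 1 y) := by
      rw [map_add, map_smul, map_smul]
      simp [dotProduct, Matrix.mulVec, Fin.sum_univ_two, SurfaceMetric.components]
      ring
    rwa [hsum]

/-- Raising the first index gives the form that `riemann_warped` takes as input. It is available at
the base point of each chart, which suffices because every spacetime point is examined in the chart
centred at it. -/
lemma HasConstantCurvature.riemann_eq {σ : SurfaceMetric F} {ε : ℝ}
    (hσ : HasConstantCurvature σ ε) (p : F) (l k i j : Fin 2) :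
    riemann (SurfaceMetric.components σ p) l k i j (chartAt (EuclideanSpace ℝ (Fin 2)) p p) =
      ε * ((if l = i then 1 else 0) *
          SurfaceMetric.components σ p (chartAt (EuclideanSpace ℝ (Fin 2)) p p) k j
        - (if l = j then 1 else 0) *
          SurfaceMetric.components σ p (chartAt (EuclideanSpace ℝ (Fin 2)) p p) k i) := by
  set x := chartAt (EuclideanSpace ℝ (Fin 2)) p p
  set γ := SurfaceMetric.components σ p
  have hdet : IsUnit (γ x).det :=
    ((components_posDef σ p (mem_chart_target _ p)).det_pos.ne').isUnit
  have hgi : ∀ i j, ∑ m, (γ x)⁻¹ i m * γ x m j = if i = j then 1 else 0 := fun i j => by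
    have := congrFun₂ (Matrix.nonsing_inv_mul _ hdet) i j
    rwa [Matrix.mul_apply, Matrix.one_apply] at this
  have h : ∀ m, ∑ n, γ x m n * riemann γ n k i j x =
      ε * (γ x m i * γ x k j - γ x m j * γ x k i) := fun m => hσ p m k i j
  calc riemann γ l k i j x
      = ∑ n, (∑ m, (γ x)⁻¹ l m * γ x m n) * riemann γ n k i j x := by simp [hgi]
    _ = ∑ m, (γ x)⁻¹ l m * ∑ n, γ x m n * riemann γ n k i j x := by
        simp only [Finset.sum_mul, Finset.mul_sum]
        rw [Finset.sum_comm]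
        exact Finset.sum_congr rfl fun m _ => Finset.sum_congr rfl fun n _ => by ring
    _ = ε * ((∑ m, (γ x)⁻¹ l m * γ x m i) * γ x k j
          - (∑ m, (γ x)⁻¹ l m * γ x m j) * γ x k i) := by
        simp only [h, Finset.sum_mul, ← Finset.sum_sub_distrib, Finset.mul_sum]
        exact Finset.sum_congr rfl fun m _ => by ring
    _ = _ := by rw [hgi, hgi]

end Surface

/-! ### Reduction of the field equations to ordinary differential equations. -/

/-- The Einstein-scalar field equations for `-dt² + a² dz² + b² σ`, reduced to ordinary
differential equations. -/
structure IsReducedSolutionAt (ε Λ : ℝ) (a b φ : ℝ → ℝ) (t : ℝ) : Prop where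
  accel_a : deriv (deriv a) t / a t + 2 * (deriv a t / a t * (deriv b t / b t)) = Λ
  accel_b : deriv (deriv b) t / b t + deriv a t / a t * (deriv b t / b t)
    + (deriv b t / b t) ^ 2 + ε / b t ^ 2 = Λ
  constraint : 2 * (deriv a t / a t * (deriv b t / b t)) + (deriv b t / b t) ^ 2 + ε / b t ^ 2
    = Λ + 4 * Real.pi * deriv φ t ^ 2
  wave : deriv (deriv φ) t + (deriv a t / a t + 2 * (deriv b t / b t)) * deriv φ t = 0

namespace Homogeneous

section Coords

variable {F : Type*} [TopologicalSpace F] [ChartedSpace (EuclideanSpace ℝ (Fin 2)) F]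

lemma spatial_coords (x : ℝ × Circle × F) :
    spatial (coords x) = chartAt (EuclideanSpace ℝ (Fin 2)) x.2.2 x.2.2 := by
  ext i
  fin_cases i <;> simp [spatial, coords]

lemma coords_zero (x : ℝ × Circle × F) : coords x 0 = x.1 := by simp [coords]

end Coords

variable {F : Type*} [TopologicalSpace F] [ChartedSpace (EuclideanSpace ℝ (Fin 2)) F]
  [IsManifold (𝓡 2) ∞ F]

lemma metric_eq_warped (σ : SurfaceMetric F) (S : Homogeneous) (p : F) :
    S.metric σ p = warped S.a S.b (SurfaceMetric.components σ p) := rfl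

lemma eventually_regularAt (σ : SurfaceMetric F) (S : Homogeneous) {x : ℝ × Circle × F}
    (hx : x ∈ S.carrier F) :
    ∀ᶠ q in 𝓝 (coords x), RegularAt S.a S.b (SurfaceMetric.components σ x.2.2) q := by
  have hI : ∀ᶠ q in 𝓝 (coords x), q 0 ∈ S.I :=
    (tendsto_time _).eventually (S.isOpen.mem_nhds (by rwa [coords_zero]))
  have hT : ∀ᶠ q in 𝓝 (coords x),
      spatial q ∈ (chartAt (EuclideanSpace ℝ (Fin 2)) x.2.2).target := by
    refine (continuous_spatial.tendsto _).eventually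
      ((chartAt (EuclideanSpace ℝ (Fin 2)) x.2.2).open_target.mem_nhds ?_)
    rw [spatial_coords]
    exact mem_chart_target _ _
  filter_upwards [hI, hT] with q hq hq'
  exact
    { contDiffAt_a := S.contDiffOn_a.contDiffAt (S.isOpen.mem_nhds hq)
      contDiffAt_b := S.contDiffOn_b.contDiffAt (S.isOpen.mem_nhds hq)
      a_ne := (S.a_pos _ hq).ne'
      b_ne := (S.b_pos _ hq).ne'
      symm := components_isSymm σ _
      det := by
        filter_upwards [(chartAt (EuclideanSpace ℝ (Fin 2)) x.2.2).open_target.mem_nhds hq']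
          with y hy
        exact ((components_posDef σ _ hy).det_pos.ne').isUnit }

lemma leafMeanCurvature_eq (σ : SurfaceMetric F) (S : Homogeneous) {x : ℝ × Circle × F}
    (hx : x ∈ S.carrier F) :
    S.leafMeanCurvature σ (fun y => y.1) x =
      deriv S.a x.1 / S.a x.1 + 2 * (deriv S.b x.1 / S.b x.1) := by
  have h := S.eventually_regularAt σ hx
  have := h.self_of_nhds.levelSetMeanCurvature_warped h
  rwa [coords_zero] at this

lemma isCMCFoliation (σ : SurfaceMetric F) (S : Homogeneous) :
    S.IsCMCFoliation σ (fun x : ℝ × Circle × F => x.1) where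
  smooth x _ := by
    change ContDiffAt ℝ ∞ (fun q : EuclideanSpace ℝ (Fin 4) => q 0) _
    fun_prop
  timelike x hx := by
    have := (S.eventually_regularAt σ hx).self_of_nhds.gradNormSq_warped (fun t => t)
    rw [metric_eq_warped]
    refine this.trans_lt ?_
    simp
  constant x hx y hy hxy := by
    rw [leafMeanCurvature_eq σ S hx, leafMeanCurvature_eq σ S hy]
    rw [show x.1 = y.1 from hxy]

lemma kretschmannScalar_eq {σ : SurfaceMetric F} {ε : ℝ} (hσ : HasConstantCurvature σ ε)
    (S : Homogeneous) {x : ℝ × Circle × F} (hx : x ∈ S.carrier F) :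
    S.kretschmannScalar σ x = 4 * (sectional ε S.a S.b x.1 0 1 ^ 2
      + 2 * sectional ε S.a S.b x.1 0 2 ^ 2
        + 2 * sectional ε S.a S.b x.1 1 2 ^ 2 + sectional ε S.a S.b x.1 2 3 ^ 2) := by
  have h := (S.eventually_regularAt σ hx).self_of_nhds
  have := h.kretschmann_warped (ε := ε) (by
    rw [spatial_coords]
    exact hσ.riemann_eq x.2.2)
  rwa [coords_zero] at this

/-- Both sides of the tensor equation are diagonal up to the surface block, where both are multiples
of γ. The tt, zz and one surface component thus carry everything. -/
lemma solvesEinsteinScalar_at_iff {σ : SurfaceMetric F} {ε : ℝ} (hσ : HasConstantCurvature σ ε)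
    (Λ : ℝ) (S : Homogeneous) {x : ℝ × Circle × F} (hx : x ∈ S.carrier F) :
    ((∀ i j, ricci (S.metric σ x.2.2) i j (coords x)
        - 1 / 2 * scalarCurvature (S.metric σ x.2.2) (coords x)
          * S.metric σ x.2.2 (coords x) i j + Λ * S.metric σ x.2.2 (coords x) i j
      = 8 * Real.pi * stressEnergy (S.metric σ x.2.2) (S.scalarField F ∘ param x.2.2) i j
          (coords x)) ∧
      waveOp (S.metric σ x.2.2) (S.scalarField F ∘ param x.2.2) (coords x) = 0) ↔
    IsReducedSolutionAt ε Λ S.a S.b S.φ x.1 := by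
  have h := (S.eventually_regularAt σ hx).self_of_nhds
  have hR : ∀ l k i j, riemann (SurfaceMetric.components σ x.2.2) l k i j (spatial (coords x)) =
      ε * ((if l = i then 1 else 0) *
          SurfaceMetric.components σ x.2.2 (spatial (coords x)) k j
        - (if l = j then 1 else 0) *
          SurfaceMetric.components σ x.2.2 (spatial (coords x)) k i) := by
    rw [spatial_coords]
    exact hσ.riemann_eq x.2.2
  have hu : S.scalarField F ∘ param x.2.2 = fun q => S.φ (q 0) := rfl
  have hγ : 0 < SurfaceMetric.components σ x.2.2 (spatial (coords x)) 0 0 := by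
    rw [spatial_coords]
    exact (components_posDef σ _ (mem_chart_target _ _)).diag_pos
  have ha := h.a_ne
  have hb := h.b_ne
  simp only [metric_eq_warped, hu, h.ricci_warped hR, h.scalarCurvature_warped hR,
    h.stressEnergy_warped, h.waveOp_warped]
  simp only [coords_zero] at ha hb ⊢
  constructor
  · rintro ⟨hE, hw⟩
    have h0 := hE 0 0
    have h1 := hE 1 1
    have h2 := hE 2 2
    clear hE
    simp [warped, sectional, Fin.sum_univ_four, coords_zero] at h0 h1 h2
    -- Cancelling a² here, and b²γ₀₀ > 0 below, leaves scalar equations; their combinations with the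
    -- tt equation isolate the second derivatives.
    have h1' := mul_right_cancel₀ (pow_ne_zero 2 ha) ((by linear_combination h1) :
      (-2 * (deriv (deriv S.b) x.1 / S.b x.1) - (deriv S.b x.1 / S.b x.1) ^ 2
        - ε / S.b x.1 ^ 2 + Λ) * S.a x.1 ^ 2 = 4 * Real.pi * deriv S.φ x.1 ^ 2 * S.a x.1 ^ 2)
    have h2' := mul_right_cancel₀ (mul_ne_zero (pow_ne_zero 2 hb) hγ.ne')
      ((by linear_combination h2) :
      (-(deriv (deriv S.a) x.1 / S.a x.1) - deriv (deriv S.b) x.1 / S.b x.1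
        - deriv S.a x.1 / S.a x.1 * (deriv S.b x.1 / S.b x.1) + Λ) *
          (S.b x.1 ^ 2 * SurfaceMetric.components σ x.2.2 (spatial (coords x)) 0 0) =
        4 * Real.pi * deriv S.φ x.1 ^ 2 *
          (S.b x.1 ^ 2 * SurfaceMetric.components σ x.2.2 (spatial (coords x)) 0 0))
    exact
      { accel_a := by linear_combination 1 / 2 * (h0 + h1') - h2'
        accel_b := by linear_combination 1 / 2 * (h0 - h1')
        constraint := by linear_combination h0
        wave := by linear_combination -hw }
  · rintro ⟨h1, h2, h3, h4⟩
    refine ⟨fun i j => ?_, by rw [h4, neg_zero]⟩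
    fin_cases i <;> fin_cases j <;> simp [warped, sectional, Fin.sum_univ_four, coords_zero]
    · linear_combination h3
    · linear_combination S.a x.1 ^ 2 * (h3 - 2 * h2)
    all_goals
      first
        | linear_combination (S.b x.1 ^ 2
            * SurfaceMetric.components σ x.2.2 (spatial (coords x)) 0 0) * (h3 - h1 - h2)
        | linear_combination (S.b x.1 ^ 2
            * SurfaceMetric.components σ x.2.2 (spatial (coords x)) 0 1) * (h3 - h1 - h2)
        | linear_combination (S.b x.1 ^ 2
            * SurfaceMetric.components σ x.2.2 (spatial (coords x)) 1 0) * (h3 - h1 - h2)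
        | linear_combination (S.b x.1 ^ 2
            * SurfaceMetric.components σ x.2.2 (spatial (coords x)) 1 1) * (h3 - h1 - h2)

lemma solvesEinsteinScalar_iff [Nonempty F] {σ : SurfaceMetric F} {ε : ℝ}
    (hσ : HasConstantCurvature σ ε) (Λ : ℝ) (S : Homogeneous) :
    S.SolvesEinsteinScalar σ Λ ↔ ∀ t ∈ S.I, IsReducedSolutionAt ε Λ S.a S.b S.φ t := by
  constructor
  · intro h t ht
    obtain ⟨p⟩ := ‹Nonempty F›
    exact (S.solvesEinsteinScalar_at_iff hσ Λ (x := (t, 1, p)) ht).1 (h (t, 1, p) ht)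
  · intro h x hx
    exact (S.solvesEinsteinScalar_at_iff hσ Λ hx).2 (h x.1 hx)

end Homogeneous

/-! ### Bounds, limits and monotonicity from derivatives. -/

section BoundedOn

/-- `f` is bounded on `s`. -/
def BddOn (f : ℝ → ℝ) (s : Set ℝ) : Prop := ∃ C, ∀ t ∈ s, |f t| ≤ C

variable {f f' g : ℝ → ℝ} {s : Set ℝ}

lemma BddOn.add (hf : BddOn f s) (hg : BddOn g s) : BddOn (fun t => f t + g t) s := by
  obtain ⟨C, hC⟩ := hf
  obtain ⟨D, hD⟩ := hg
  exact ⟨C + D, fun t ht => (abs_add_le _ _).trans (add_le_add (hC t ht) (hD t ht))⟩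

lemma BddOn.mul (hf : BddOn f s) (hg : BddOn g s) : BddOn (fun t => f t * g t) s := by
  obtain ⟨C, hC⟩ := hf
  obtain ⟨D, hD⟩ := hg
  refine ⟨C * D, fun t ht => ?_⟩
  rw [abs_mul]
  exact mul_le_mul (hC t ht) (hD t ht) (abs_nonneg _) ((abs_nonneg _).trans (hC t ht))

lemma BddOn.const (c : ℝ) : BddOn (fun _ => c) s := ⟨|c|, fun _ _ => le_rfl⟩

lemma BddOn.congr (hf : BddOn f s) (h : ∀ t ∈ s, f t = g t) : BddOn g s := by
  obtain ⟨C, hC⟩ := hf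
  exact ⟨C, fun t ht => h t ht ▸ hC t ht⟩

lemma BddOn.of_continuous (hf : Continuous f) {t₀ T : ℝ} : BddOn f (Ico t₀ T) := by
  obtain ⟨C, hC⟩ := (isCompact_Icc (a := t₀) (b := T)).exists_bound_of_continuousOn
    hf.continuousOn
  exact ⟨C, fun t ht => hC t (Ico_subset_Icc_self ht)⟩

lemma BddOn.of_hasDerivAt {t₀ T : ℝ} (hf : ∀ t ∈ Ico t₀ T, HasDerivAt f (f' t) t)
    (hb : BddOn f' (Ico t₀ T)) : BddOn f (Ico t₀ T) := by
  obtain ⟨C, hC⟩ := hb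
  refine ⟨|f t₀| + C * (T - t₀), fun t ht => ?_⟩
  have h0 : t₀ ∈ Ico t₀ T := ⟨le_rfl, ht.1.trans_lt ht.2⟩
  have := (convex_Ico t₀ T).norm_image_sub_le_of_norm_hasDerivWithin_le
    (fun x hx => (hf x hx).hasDerivWithinAt) hC h0 ht
  have hC0 : 0 ≤ C := (abs_nonneg _).trans (hC t ht)
  rw [Real.norm_eq_abs, Real.norm_eq_abs, abs_of_nonneg (sub_nonneg.2 ht.1)] at this
  have h2 : C * (t - t₀) ≤ C * (T - t₀) := by
    gcongr
    exact ht.2.le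
  have h3 := abs_sub_abs_le_abs_sub (f t) (f t₀)
  linarith

/-- The function is Lipschitz, hence extends continuously to the line; the value of the extension at
T is the limit. -/
lemma exists_tendsto_of_bddOn_deriv {t₀ T : ℝ} (hT : t₀ < T)
    (hf : ∀ t ∈ Ico t₀ T, HasDerivAt f (f' t) t) (hb : BddOn f' (Ico t₀ T)) :
    ∃ L, Tendsto f (𝓝[<] T) (𝓝 L) := by
  obtain ⟨C, hC⟩ := hb
  have hlip : LipschitzOnWith C.toNNReal f (Ico t₀ T) := by
    refine (convex_Ico t₀ T).lipschitzOnWith_of_nnnorm_hasDerivWithin_le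
      (fun x hx => (hf x hx).hasDerivWithinAt) fun x hx => ?_
    rw [← NNReal.coe_le_coe, coe_nnnorm]
    exact (hC x hx).trans (Real.le_coe_toNNReal C)
  obtain ⟨g, hg, hfg⟩ := hlip.extend_real
  refine ⟨g T, (hg.continuous.continuousAt.tendsto.mono_left nhdsWithin_le_nhds).congr' ?_⟩
  filter_upwards [Ico_mem_nhdsLT hT] with t ht using (hfg ht).symm

lemma antitoneOn_of_hasDerivAt_nonpos {I : Set ℝ} (hI : Convex ℝ I)
    (hf : ∀ t ∈ I, HasDerivAt f (f' t) t) (h : ∀ t ∈ I, f' t ≤ 0) : AntitoneOn f I :=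
  antitoneOn_of_hasDerivWithinAt_nonpos hI
    (fun t ht => (hf t ht).continuousAt.continuousWithinAt)
    (fun t ht => (hf t (interior_subset ht)).hasDerivWithinAt)
    fun t ht => h t (interior_subset ht)

lemma monotoneOn_of_hasDerivAt_nonneg {I : Set ℝ} (hI : Convex ℝ I)
    (hf : ∀ t ∈ I, HasDerivAt f (f' t) t) (h : ∀ t ∈ I, 0 ≤ f' t) : MonotoneOn f I :=
  monotoneOn_of_hasDerivWithinAt_nonneg hI
    (fun t ht => (hf t ht).continuousAt.continuousWithinAt)
    (fun t ht => (hf t (interior_subset ht)).hasDerivWithinAt)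
    fun t ht => h t (interior_subset ht)

lemma eq_of_hasDerivAt_zero {I : Set ℝ} (hI : Convex ℝ I)
    (hf : ∀ t ∈ I, HasDerivAt f 0 t) {s t : ℝ} (hs : s ∈ I) (ht : t ∈ I) : f s = f t := by
  have h1 := antitoneOn_of_hasDerivAt_nonpos hI hf fun _ _ => le_rfl
  have h2 := monotoneOn_of_hasDerivAt_nonneg hI hf fun _ _ => le_rfl
  rcases le_total s t with h | h
  · exact le_antisymm (h2 hs ht h) (h1 hs ht h)
  · exact le_antisymm (h1 ht hs h) (h2 ht hs h)

end BoundedOn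

/-! ### The first-order system: conserved quantities, Raychaudhuri's equation, finite lifetime. -/

section Flow

/-- The vector field of the reduced Einstein-scalar field equations, for the variables
`(a, b, ȧ/a, ḃ/b, φ, φ̇)`. -/
def flowField (Λ ε : ℝ) (y : Fin 6 → ℝ) : Fin 6 → ℝ :=
  ![y 0 * y 2, y 1 * y 3, Λ - y 2 * (y 2 + 2 * y 3),
    Λ - ε / y 1 ^ 2 - y 3 * (y 2 + 2 * y 3), y 5, -(y 2 + 2 * y 3) * y 5]

/-- The Hamiltonian constraint. -/
def hamiltonian (Λ ε : ℝ) (y : Fin 6 → ℝ) : ℝ :=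
  2 * y 2 * y 3 + y 3 ^ 2 + ε / y 1 ^ 2 - Λ - 4 * Real.pi * y 5 ^ 2

/-- The volume expansion rate. -/
def expansion (y : Fin 6 → ℝ) : ℝ := y 2 + 2 * y 3

/-- The volume density. -/
def vol (y : Fin 6 → ℝ) : ℝ := y 0 * y 1 ^ 2

/-- `y` solves the evolution equations at time `t`. -/
def FlowsAt (Λ ε : ℝ) (y : ℝ → Fin 6 → ℝ) (t : ℝ) : Prop :=
  HasDerivAt y (flowField Λ ε (y t)) t

/-- Solutions of the reduced Einstein-scalar field equations in first-order form. -/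
structure IsFlow (Λ ε : ℝ) (y : ℝ → Fin 6 → ℝ) (I : Set ℝ) : Prop where
  flowsAt : ∀ t ∈ I, FlowsAt Λ ε y t
  a_pos : ∀ t ∈ I, 0 < y t 0
  b_pos : ∀ t ∈ I, 0 < y t 1
  constraint : ∀ t ∈ I, hamiltonian Λ ε (y t) = 0

variable {Λ ε : ℝ} {y : ℝ → Fin 6 → ℝ} {t : ℝ}

lemma FlowsAt.coord (h : FlowsAt Λ ε y t) (i : Fin 6) :
    HasDerivAt (fun t => y t i) (flowField Λ ε (y t) i) t :=
  (hasDerivAt_pi.1 h) i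

lemma FlowsAt.hasDerivAt_vol (h : FlowsAt Λ ε y t) :
    HasDerivAt (fun t => vol (y t)) (expansion (y t) * vol (y t)) t := by
  refine (((h.coord 0).mul ((h.coord 1).pow 2))).congr_deriv ?_
  simp [flowField, Recollapse.vol, expansion]
  ring

/-- Along the evolution the constraint function C satisfies C' = -2θC, while V' = θV. The constraint
itself is not assumed, so its vanishing can be propagated. -/
lemma FlowsAt.hasDerivAt_constraint (h : FlowsAt Λ ε y t) (hb : y t 1 ≠ 0) :
    HasDerivAt (fun t => hamiltonian Λ ε (y t) * vol (y t) ^ 2) 0 t := by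
  have h1 := (((((h.coord 2).const_mul 2).mul (h.coord 3)).add ((h.coord 3).pow 2)).add
    (((h.coord 1).pow 2).inv (pow_ne_zero 2 hb) |>.const_mul ε)).sub_const Λ
  have h2 := (h1.sub (((h.coord 5).pow 2).const_mul (4 * Real.pi))).mul (h.hasDerivAt_vol.pow 2)
  refine (h2.congr_deriv ?_).congr_of_eventuallyEq (Eventually.of_forall fun s => ?_)
  · simp [flowField, Recollapse.vol, expansion]
    field_simp
    ring
  · simp [hamiltonian, div_eq_mul_inv]

namespace IsFlow

variable {I : Set ℝ}

lemma vol_pos (h : IsFlow Λ ε y I) (ht : t ∈ I) : 0 < vol (y t) :=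
  mul_pos (h.a_pos t ht) (pow_pos (h.b_pos t ht) 2)

/-- Raychaudhuri's equation. Twice the constraint removes HK and ε/b², leaving only nonpositive
terms when Λ ≤ 0. -/
lemma hasDerivAt_expansion (h : IsFlow Λ ε y I) (ht : t ∈ I) :
    HasDerivAt (fun t => expansion (y t))
      (Λ - 8 * Real.pi * y t 5 ^ 2 - y t 2 ^ 2 - 2 * y t 3 ^ 2) t := by
  have h' := h.flowsAt t ht
  refine ((h'.coord 2).add ((h'.coord 3).const_mul 2)).congr_deriv ?_
  have hc := h.constraint t ht
  simp only [hamiltonian] at hc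
  simp [flowField]
  linear_combination -2 * hc

/-- Multiplication by V absorbs the friction term -θH, so HV is controlled by V alone. -/
lemma hasDerivAt_expansion_a (h : IsFlow Λ ε y I) (ht : t ∈ I) :
    HasDerivAt (fun t => y t 2 * vol (y t)) (Λ * vol (y t)) t := by
  have h' := h.flowsAt t ht
  refine ((h'.coord 2).mul h'.hasDerivAt_vol).congr_deriv ?_
  simp [flowField, expansion]
  ring

lemma hasDerivAt_expansion_b (h : IsFlow Λ ε y I) (ht : t ∈ I) :
    HasDerivAt (fun t => y t 3 * vol (y t)) (Λ * vol (y t) + -ε * y t 0) t := by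
  have h' := h.flowsAt t ht
  have hb := (h.b_pos t ht).ne'
  refine ((h'.coord 3).mul h'.hasDerivAt_vol).congr_deriv ?_
  simp [flowField, expansion, vol]
  field_simp
  ring

lemma hasDerivAt_momentum (h : IsFlow Λ ε y I) (ht : t ∈ I) :
    HasDerivAt (fun t => y t 5 * vol (y t)) 0 t := by
  have h' := h.flowsAt t ht
  refine ((h'.coord 5).mul h'.hasDerivAt_vol).congr_deriv ?_
  simp [flowField, expansion]
  ring

/-- Comparison of V with exp(ct): the sign of θ - c decides monotonicity. It yields both upper and
lower bounds on V. -/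
lemma hasDerivAt_vol_mul_exp (h : IsFlow Λ ε y I) (c : ℝ) (ht : t ∈ I) :
    HasDerivAt (fun t => vol (y t) * Real.exp (-(c * t)))
      ((expansion (y t) - c) * (vol (y t) * Real.exp (-(c * t)))) t := by
  refine ((h.flowsAt t ht).hasDerivAt_vol.mul
    (((hasDerivAt_id t).const_mul c).neg.exp)).congr_deriv ?_
  simp
  ring

lemma mono {J : Set ℝ} (h : IsFlow Λ ε y I) (hJ : J ⊆ I) : IsFlow Λ ε y J :=
  ⟨fun t ht => h.flowsAt t (hJ ht), fun t ht => h.a_pos t (hJ ht),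
    fun t ht => h.b_pos t (hJ ht), fun t ht => h.constraint t (hJ ht)⟩

lemma expansion_antitoneOn (h : IsFlow Λ ε y I) (hΛ : Λ < 0) (hI : Convex ℝ I) :
    AntitoneOn (fun t => expansion (y t)) I :=
  antitoneOn_of_hasDerivAt_nonpos hI (fun t ht => h.hasDerivAt_expansion ht) fun t _ => by
    have := Real.pi_pos
    nlinarith [sq_nonneg (y t 2), sq_nonneg (y t 3), mul_nonneg this.le (sq_nonneg (y t 5))]

/-- The lifetime of a solution is bounded. -/
lemma length_le (h : IsFlow Λ ε y I) (hΛ : Λ < 0) (hI : Convex ℝ I) {s t : ℝ}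
    (hs : s ∈ I) (ht : t ∈ I) : min (-Λ) (1 / 3) * (t - s) ≤ Real.pi := by
  set m := min (-Λ) (1 / 3)
  have hm1 : m ≤ -Λ := min_le_left _ _
  have hm2 : m ≤ 1 / 3 := min_le_right _ _
  have hm : 0 < m := lt_min (by linarith) (by norm_num)
  rcases lt_or_ge t s with hst | hst
  · nlinarith [Real.pi_pos]
  -- Since θ' ≤ -m(1 + θ²), arctan θ falls at rate at least m, and its range has length π.
  have hanti : AntitoneOn (fun t => Real.arctan (expansion (y t)) + m * t) I :=
    antitoneOn_of_hasDerivAt_nonpos hI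
      (fun t ht => (h.hasDerivAt_expansion ht).arctan.add ((hasDerivAt_id t).const_mul m))
      fun t _ => by
        have hpos : 0 < 1 + expansion (y t) ^ 2 := by positivity
        have hle : Λ - 8 * Real.pi * y t 5 ^ 2 - y t 2 ^ 2 - 2 * y t 3 ^ 2 ≤
            -m * (1 + expansion (y t) ^ 2) := by
          -- Cauchy–Schwarz with weights 1 and 2.
          have h1 : expansion (y t) ^ 2 ≤ 3 * (y t 2 ^ 2 + 2 * y t 3 ^ 2) := by
            unfold expansion
            nlinarith [sq_nonneg (y t 2 - y t 3)]
          have h2 := mul_nonneg Real.pi_pos.le (sq_nonneg (y t 5))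
          have h3 : m * expansion (y t) ^ 2 ≤ 1 / 3 * expansion (y t) ^ 2 := by gcongr
          linarith
        rw [mul_one, one_div, inv_mul_eq_div, ← sub_neg_eq_add, sub_nonpos, div_le_iff₀ hpos]
        exact hle
  have := hanti hs ht hst
  simp only at this
  have h1 := Real.arctan_lt_pi_div_two (expansion (y s))
  have h2 := Real.neg_pi_div_two_lt_arctan (expansion (y t))
  linarith

end IsFlow
end Flow

/-! ### Continuation criterion and behaviour at the future end. -/

section Extension

variable {Λ ε : ℝ} {y : ℝ → Fin 6 → ℝ} {Tm T : ℝ}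

lemma contDiffAt_flowField (Λ ε : ℝ) {x : Fin 6 → ℝ} (hx : x 1 ≠ 0) (n : ℕ∞) :
    ContDiffAt ℝ n (flowField Λ ε) x := by
  have hc : ∀ i, ContDiffAt ℝ n (fun y : Fin 6 → ℝ => y i) x := fun i =>
    (contDiff_apply ℝ ℝ i).contDiffAt
  refine contDiffAt_pi.2 fun i => ?_
  fin_cases i <;> simp only [flowField, Fin.zero_eta, Fin.mk_one, Fin.reduceFinMk,
    Matrix.cons_val]
  · exact (hc 0).mul (hc 2)
  · exact (hc 1).mul (hc 3)
  · exact contDiffAt_const.sub ((hc 2).mul ((hc 2).add (contDiffAt_const.mul (hc 3))))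
  · exact (contDiffAt_const.sub (contDiffAt_const.div ((hc 1).pow 2) (pow_ne_zero 2 hx))).sub
      ((hc 3).mul ((hc 2).add (contDiffAt_const.mul (hc 3))))
  · exact hc 5
  · exact ((hc 2).add (contDiffAt_const.mul (hc 3))).neg.mul (hc 5)

/-- A positive function with bounded logarithmic derivative is bounded away from zero. -/
lemma exists_le_of_bddOn_log_deriv {f H : ℝ → ℝ} {t₀ : ℝ}
    (hf : ∀ t ∈ Ico t₀ T, HasDerivAt f (f t * H t) t) (hpos : ∀ t ∈ Ico t₀ T, 0 < f t)
    (hH : BddOn H (Ico t₀ T)) : (∃ c > 0, ∀ t ∈ Ico t₀ T, c ≤ f t) ∧ BddOn f (Ico t₀ T) := by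
  obtain ⟨C, hC⟩ := BddOn.of_hasDerivAt (f := fun t => Real.log (f t)) (f' := H)
    (fun t ht => ((hf t ht).log (hpos t ht).ne').congr_deriv
      (by field_simp [(hpos t ht).ne'])) hH
  refine ⟨⟨Real.exp (-C), Real.exp_pos _, fun t ht => ?_⟩, Real.exp C, fun t ht => ?_⟩
  · rw [← Real.exp_log (hpos t ht)]
    exact Real.exp_le_exp.2 (neg_le_of_abs_le (hC t ht))
  · rw [abs_of_pos (hpos t ht), ← Real.exp_log (hpos t ht)]
    exact Real.exp_le_exp.2 (le_of_abs_le (hC t ht))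

/-- The bounds come in a forced order: V, then H and a, then K and b, because (KV)' contains εa.
With φ̇V constant the whole vector field is bounded, so each variable converges. -/
lemma IsFlow.exists_limit (h : IsFlow Λ ε y (Ioo Tm T)) (hΛ : Λ < 0) {t₀ v : ℝ}
    (ht₀ : t₀ ∈ Ioo Tm T) (hv : 0 < v) (hV : ∀ t ∈ Ico t₀ T, v ≤ vol (y t)) :
    ∃ L : Fin 6 → ℝ, Tendsto y (𝓝[<] T) (𝓝 L) ∧ 0 < L 0 ∧ 0 < L 1 := by
  have hsub : Ico t₀ T ⊆ Ioo Tm T := fun t ht => ⟨ht₀.1.trans_le ht.1, ht.2⟩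
  replace h := h.mono hsub
  have hT := ht₀.2
  have h0 : t₀ ∈ Ico t₀ T := ⟨le_rfl, hT⟩
  have hVpos : ∀ t ∈ Ico t₀ T, 0 < vol (y t) := fun t ht => h.vol_pos ht
  have bV : BddOn (fun t => vol (y t)) (Ico t₀ T) := by
    -- As θ is decreasing, θ ≤ c from t₀ on, so V grows at most like exp(ct).
    set c := expansion (y t₀)
    have hanti := antitoneOn_of_hasDerivAt_nonpos (convex_Ico t₀ T)
      (fun t ht => h.hasDerivAt_vol_mul_exp c ht) fun t ht => by
        have h1 : expansion (y t) ≤ c :=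
          h.expansion_antitoneOn hΛ (convex_Ico t₀ T) h0 ht ht.1
        exact mul_nonpos_of_nonpos_of_nonneg (by linarith)
          (mul_pos (hVpos t ht) (Real.exp_pos _)).le
    have b1 : BddOn (fun t => vol (y t) * Real.exp (-(c * t))) (Ico t₀ T) :=
      ⟨_, fun t ht => by
        rw [abs_of_pos (mul_pos (hVpos t ht) (Real.exp_pos _))]
        exact hanti h0 ht ht.1⟩
    refine (b1.mul (BddOn.of_continuous (f := fun t => Real.exp (c * t)) (by fun_prop))).congr
      fun t _ => ?_
    rw [mul_assoc, ← Real.exp_add]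
    simp
  have bVi : BddOn (fun t => (vol (y t))⁻¹) (Ico t₀ T) :=
    ⟨v⁻¹, fun t ht => by
      rw [abs_of_pos (inv_pos.2 (hVpos t ht))]
      exact inv_anti₀ hv (hV t ht)⟩
  have hdiv : ∀ i, BddOn (fun t => y t i * vol (y t)) (Ico t₀ T) →
      BddOn (fun t => y t i) (Ico t₀ T) := fun i hi =>
    (hi.mul bVi).congr fun t ht => mul_inv_cancel_right₀ (hVpos t ht).ne' _
  have b2 : BddOn (fun t => y t 2) (Ico t₀ T) := hdiv 2
    (BddOn.of_hasDerivAt (fun t ht => h.hasDerivAt_expansion_a ht) ((BddOn.const Λ).mul bV))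
  obtain ⟨⟨ca, hca, hca'⟩, b0⟩ := exists_le_of_bddOn_log_deriv (f := fun t => y t 0)
    (fun t ht => (h.flowsAt t ht).coord 0) h.a_pos b2
  have b3 : BddOn (fun t => y t 3) (Ico t₀ T) := hdiv 3
    (BddOn.of_hasDerivAt (fun t ht => h.hasDerivAt_expansion_b ht)
      (((BddOn.const Λ).mul bV).add ((BddOn.const (-ε)).mul b0)))
  obtain ⟨⟨cb, hcb, hcb'⟩, b1⟩ := exists_le_of_bddOn_log_deriv (f := fun t => y t 1)
    (fun t ht => (h.flowsAt t ht).coord 1) h.b_pos b3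
  have b5 : BddOn (fun t => y t 5) (Ico t₀ T) := hdiv 5
    (BddOn.of_hasDerivAt (fun t ht => h.hasDerivAt_momentum ht) (BddOn.const 0))
  -- Here 1/b² = a/V.
  have bi : BddOn (fun t => (y t 1 ^ 2)⁻¹) (Ico t₀ T) :=
    (b0.mul bVi).congr fun t ht => by
      have := (h.a_pos t ht).ne'
      simp only [vol]
      field_simp
  have bθ : BddOn (fun t => y t 2 + 2 * y t 3) (Ico t₀ T) := b2.add ((BddOn.const 2).mul b3)
  have bF : ∀ i, BddOn (fun t => flowField Λ ε (y t) i) (Ico t₀ T) := by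
    intro i
    fin_cases i
    · exact b0.mul b2
    · exact b1.mul b3
    · exact ((BddOn.const Λ).add ((BddOn.const (-1)).mul (b2.mul bθ))).congr
        fun t _ => by simp [flowField]; ring
    · exact (((BddOn.const Λ).add ((BddOn.const (-ε)).mul bi)).add
        ((BddOn.const (-1)).mul (b3.mul bθ))).congr fun t _ => by simp [flowField]; ring
    · exact b5
    · exact ((BddOn.const (-1)).mul (bθ.mul b5)).congr fun t _ => by simp [flowField]; ring
  choose L hL using fun i => exists_tendsto_of_bddOn_deriv hT
    (fun t ht => (h.flowsAt t ht).coord i) (bF i)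
  have hmem : ∀ᶠ t in 𝓝[<] T, t ∈ Ico t₀ T := Ico_mem_nhdsLT hT
  exact ⟨L, tendsto_pi_nhds.2 hL,
    hca.trans_le (ge_of_tendsto (hL 0) (hmem.mono fun t ht => hca' t ht)),
    hcb.trans_le (ge_of_tendsto (hL 1) (hmem.mono fun t ht => hcb' t ht))⟩

/-- A solution that has a limit at the end of its interval of existence can be continued. -/
lemma IsFlow.exists_extension (h : IsFlow Λ ε y (Ioo Tm T)) (hT : Tm < T) {L : Fin 6 → ℝ}
    (hL : Tendsto y (𝓝[<] T) (𝓝 L)) (hL0 : 0 < L 0) (hL1 : 0 < L 1) :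
    ∃ δ > 0, ∃ z, IsFlow Λ ε z (Ioo Tm (T + δ)) ∧ EqOn z y (Ioo Tm T) := by
  -- Local existence through the limit L, where the vector field is smooth because its b-component
  -- is nonzero.
  obtain ⟨α, hα, δ₁, hδ₁, hα'⟩ :=
    (contDiffAt_flowField Λ ε hL1.ne' 1)
      |>.exists_forall_mem_closedBall_exists_eq_forall_mem_Ioo_hasDerivAt₀ T
  have hαT : HasDerivAt α (flowField Λ ε L) T := by
    have := hα' T ⟨by linarith, by linarith⟩
    rwa [hα] at this
  have hαpos : ∀ᶠ t in 𝓝 T, 0 < α t 0 ∧ 0 < α t 1 := by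
    have hc : ∀ i, Tendsto (fun t => α t i) (𝓝 T) (𝓝 (L i)) := fun i => by
      rw [← hα]
      exact tendsto_pi_nhds.1 hαT.continuousAt.tendsto i
    exact ((hc 0).eventually (lt_mem_nhds hL0)).and ((hc 1).eventually (lt_mem_nhds hL1))
  obtain ⟨δ₂, hδ₂, hball⟩ := Metric.eventually_nhds_iff.1 hαpos
  set z : ℝ → Fin 6 → ℝ := fun t => if t < T then y t else α t with hz
  have hzy : ∀ t, t < T → z t = y t := fun t ht => if_pos ht
  have hzα : ∀ t, T ≤ t → z t = α t := fun t ht => if_neg ht.not_gt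
  have hzT : z T = L := by rw [hzα T le_rfl, hα]
  have hzy' : ∀ t, t < T → z =ᶠ[𝓝 t] y := fun t ht => by
    filter_upwards [Iio_mem_nhds ht] with s hs using hzy s hs
  set δ := min δ₁ δ₂ with hδ
  have hflow : ∀ t ∈ Ioo Tm (T + δ), FlowsAt Λ ε z t := by
    intro t ht
    rcases lt_trichotomy t T with hlt | rfl | hgt
    · have := h.flowsAt t ⟨ht.1, hlt⟩
      unfold FlowsAt at this ⊢
      rw [hzy t hlt]
      exact this.congr_of_eventuallyEq (hzy' t hlt)
    · have hI : Ioo Tm t ∈ 𝓝[<] t := Ioo_mem_nhdsLT ht.1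
      -- At the junction the left derivative is the limit of derivatives of y, and it matches the
      -- right derivative of α since both equal the vector field at L.
      have hleft : HasDerivWithinAt z (flowField Λ ε L) (Iic t) t := by
        refine hasDerivWithinAt_Iic_of_tendsto_deriv (s := Ioo Tm t) ?_ ?_ hI ?_
        · intro s hs
          exact ((h.flowsAt s hs).congr_of_eventuallyEq
            (hzy' s hs.2)).differentiableAt.differentiableWithinAt
        · unfold ContinuousWithinAt
          rw [hzT]
          refine (hL.congr' ?_).mono_left (nhdsWithin_mono _ fun s hs => hs.2)
          filter_upwards [self_mem_nhdsWithin] with s hs using (hzy s hs).symm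
        · refine Tendsto.congr' ?_ ((contDiffAt_flowField Λ ε hL1.ne' 0).continuousAt.tendsto.comp hL)
          filter_upwards [hI] with s hs
          exact ((h.flowsAt s hs).congr_of_eventuallyEq (hzy' s hs.2)).deriv.symm
      have hright : HasDerivWithinAt z (flowField Λ ε L) (Ici t) t :=
        hαT.hasDerivWithinAt.congr (fun s hs => hzα s hs) (hzα t le_rfl)
      have := hleft.union hright
      rw [Iic_union_Ici, hasDerivWithinAt_univ] at this
      unfold FlowsAt
      rwa [hzT]
    · have := hα' t ⟨by linarith, by linarith [ht.2, min_le_left δ₁ δ₂]⟩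
      unfold FlowsAt
      rw [hzα t hgt.le]
      refine this.congr_of_eventuallyEq ?_
      filter_upwards [Ioi_mem_nhds hgt] with s hs using hzα s (le_of_lt hs)
  have hpos : ∀ t ∈ Ioo Tm (T + δ), 0 < z t 0 ∧ 0 < z t 1 := by
    intro t ht
    rcases lt_or_ge t T with hlt | hge
    · rw [hzy t hlt]
      exact ⟨h.a_pos t ⟨ht.1, hlt⟩, h.b_pos t ⟨ht.1, hlt⟩⟩
    · rw [hzα t hge]
      refine hball ?_
      rw [Real.dist_eq, abs_of_nonneg (by linarith)]
      linarith [ht.2, min_le_right δ₁ δ₂]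
  refine ⟨δ, lt_min hδ₁ hδ₂, z, ⟨hflow, fun t ht => (hpos t ht).1, fun t ht => (hpos t ht).2,
    fun t ht => ?_⟩, fun t ht => hzy t ht.2⟩
  obtain ⟨s, hs⟩ := nonempty_Ioo.2 hT
  have hs' : s ∈ Ioo Tm (T + δ) := ⟨hs.1, by linarith [hs.2, lt_min hδ₁ hδ₂]⟩
  -- The constraint spreads from an old time s to the extension by conservation.
  have := eq_of_hasDerivAt_zero (convex_Ioo Tm (T + δ))
    (fun t ht => (hflow t ht).hasDerivAt_constraint (hpos t ht).2.ne') ht hs'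
  rw [hzy s hs.2, h.constraint s hs, zero_mul] at this
  refine (mul_eq_zero.1 this).resolve_right (pow_ne_zero 2 ?_)
  exact (mul_pos (hpos t ht).1 (pow_pos (hpos t ht).2 2)).ne'

/-- `y` cannot be continued beyond the future end of the interval `(Tm, T)`. -/
def FutureInextendible (Λ ε : ℝ) (y : ℝ → Fin 6 → ℝ) (Tm T : ℝ) : Prop :=
  ∀ δ > 0, ∀ z, IsFlow Λ ε z (Ioo Tm (T + δ)) → ¬ EqOn z y (Ioo Tm T)

lemma IsFlow.exists_vol_lt (h : IsFlow Λ ε y (Ioo Tm T)) (hΛ : Λ < 0)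
    (hmax : FutureInextendible Λ ε y Tm T) {t₀ v : ℝ} (ht₀ : t₀ ∈ Ioo Tm T) (hv : 0 < v) :
    ∃ t ∈ Ico t₀ T, vol (y t) < v := by
  by_contra! hV
  obtain ⟨L, hL, hL0, hL1⟩ := h.exists_limit hΛ ht₀ hv hV
  obtain ⟨δ, hδ, z, hz, hzy⟩ := h.exists_extension (ht₀.1.trans ht₀.2) hL hL0 hL1
  exact hmax δ hδ z hz hzy

/-- If θ stayed above some c, then V exp(-ct) would increase and bound V below, contradicting
`exists_vol_lt`. Monotonicity of θ turns one small value into the limit. -/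
lemma IsFlow.tendsto_expansion_atBot (h : IsFlow Λ ε y (Ioo Tm T)) (hΛ : Λ < 0)
    (hmax : FutureInextendible Λ ε y Tm T) (hT : Tm < T) :
    Tendsto (fun t => expansion (y t)) (𝓝[<] T) atBot := by
  refine tendsto_atBot.2 fun c => ?_
  have : ∃ t ∈ Ioo Tm T, expansion (y t) ≤ c := by
    by_contra! hc
    obtain ⟨t₀, ht₀⟩ := nonempty_Ioo.2 hT
    have hmono := monotoneOn_of_hasDerivAt_nonneg (convex_Ioo Tm T)
      (fun t ht => h.hasDerivAt_vol_mul_exp c ht) fun t ht =>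
        mul_nonneg (by linarith [hc t ht]) (mul_pos (h.vol_pos ht) (Real.exp_pos _)).le
    obtain ⟨C, hC⟩ := BddOn.of_continuous (f := fun t => Real.exp (-(c * t))) (by fun_prop)
      (t₀ := t₀) (T := T)
    have hC0 : 0 < C := (abs_pos.2 (Real.exp_pos _).ne').trans_le (hC t₀ ⟨le_rfl, ht₀.2⟩)
    have hm : 0 < vol (y t₀) * Real.exp (-(c * t₀)) :=
      mul_pos (h.vol_pos ht₀) (Real.exp_pos _)
    obtain ⟨t, ht, hlt⟩ := h.exists_vol_lt hΛ hmax ht₀ (div_pos hm hC0)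
    have htI : t ∈ Ioo Tm T := ⟨ht₀.1.trans_le ht.1, ht.2⟩
    rw [lt_div_iff₀ hC0] at hlt
    have h1 := hmono ht₀ htI ht.1
    have h2 : vol (y t) * Real.exp (-(c * t)) ≤ vol (y t) * C :=
      mul_le_mul_of_nonneg_left ((le_abs_self _).trans (hC t ht)) (h.vol_pos htI).le
    simp only at h1
    linarith
  obtain ⟨t₁, ht₁, hle⟩ := this
  filter_upwards [Ioo_mem_nhdsLT ht₁.2] with t ht
  exact (h.expansion_antitoneOn hΛ (convex_Ioo Tm T) ht₁ ⟨ht₁.1.trans ht.1, ht.2⟩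
    ht.1.le).trans hle

/-- Once θ ≤ 0 the volume decreases, so its arbitrarily small values persist. -/
lemma IsFlow.tendsto_vol_zero (h : IsFlow Λ ε y (Ioo Tm T)) (hΛ : Λ < 0)
    (hmax : FutureInextendible Λ ε y Tm T) (hT : Tm < T) :
    Tendsto (fun t => vol (y t)) (𝓝[<] T) (𝓝[>] 0) := by
  refine tendsto_nhdsWithin_iff.2 ⟨?_, ?_⟩
  swap
  · filter_upwards [Ioo_mem_nhdsLT hT] with t ht using h.vol_pos ht
  obtain ⟨t₁, hneg, ht₁⟩ := (((h.tendsto_expansion_atBot hΛ hmax hT).eventually_le_atBot 0).and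
    (Ioo_mem_nhdsLT hT)).exists
  have hsub : Ico t₁ T ⊆ Ioo Tm T := fun t ht => ⟨ht₁.1.trans_le ht.1, ht.2⟩
  have hanti := antitoneOn_of_hasDerivAt_nonpos (convex_Ico t₁ T)
    (fun t ht => (h.flowsAt t (hsub ht)).hasDerivAt_vol) fun t ht =>
      mul_nonpos_of_nonpos_of_nonneg ((h.expansion_antitoneOn hΛ (convex_Ioo Tm T) ht₁
        (hsub ht) ht.1).trans hneg) (h.vol_pos (hsub ht)).le
  refine (nhds_basis_Ioo_pos (0 : ℝ)).tendsto_right_iff.2 fun v hv => ?_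
  obtain ⟨t₂, ht₂, hlt⟩ := h.exists_vol_lt hΛ hmax ht₁ hv
  filter_upwards [Ico_mem_nhdsLT ht₂.2] with t ht
  have ht' : t ∈ Ico t₁ T := ⟨ht₂.1.trans ht.1, ht.2⟩
  have := hanti ht₂ ht' ht.1
  simp only at this
  exact ⟨by linarith [h.vol_pos (hsub ht')], by linarith⟩

/-- The kinetic energy of a nontrivial scalar field blows up at the end of a maximal solution. -/
lemma IsFlow.tendsto_kinetic_atTop (h : IsFlow Λ ε y (Ioo Tm T)) (hΛ : Λ < 0)
    (hmax : FutureInextendible Λ ε y Tm T) {t₀ : ℝ} (ht₀ : t₀ ∈ Ioo Tm T) (hφ : y t₀ 5 ≠ 0) :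
    Tendsto (fun t => y t 5 ^ 2) (𝓝[<] T) atTop := by
  have hT : Tm < T := ht₀.1.trans ht₀.2
  have hV := (tendsto_inv_nhdsGT_zero.comp (h.tendsto_vol_zero hΛ hmax hT))
  -- The conserved p = φ̇V is nonzero, and φ̇² = p²/V².
  have h1 := (hV.atTop_mul_atTop₀ hV).const_mul_atTop
    (pow_pos (abs_pos.2 (mul_ne_zero hφ (h.vol_pos ht₀).ne')) 2)
  refine h1.congr' ?_
  filter_upwards [Ioo_mem_nhdsLT hT] with t ht
  have := eq_of_hasDerivAt_zero (convex_Ioo Tm T) (fun t ht => h.hasDerivAt_momentum ht) ht₀ ht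
  have hv := (h.vol_pos ht).ne'
  simp only [Function.comp_apply, sq_abs]
  rw [this]
  field_simp

end Extension

/-! ### Time reversal. -/

section Reversal

variable {Λ ε : ℝ} {y : ℝ → Fin 6 → ℝ} {a b : ℝ}

/-- Time reversal of a solution of the reduced equations. -/
def timeReverse (y : ℝ → Fin 6 → ℝ) (t : ℝ) : Fin 6 → ℝ :=
  ![y (-t) 0, y (-t) 1, -y (-t) 2, -y (-t) 3, y (-t) 4, -y (-t) 5]

lemma timeReverse_timeReverse (y : ℝ → Fin 6 → ℝ) : timeReverse (timeReverse y) = y := by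
  ext t i
  fin_cases i <;> simp [timeReverse]

/-- Only H, K and φ̇ change sign; the constraint is invariant because it is quadratic in them. -/
lemma IsFlow.timeReverse (h : IsFlow Λ ε y (Ioo a b)) :
    IsFlow Λ ε (timeReverse y) (Ioo (-b) (-a)) := by
  have hmem : ∀ t ∈ Ioo (-b) (-a), -t ∈ Ioo a b := fun t ht =>
    ⟨by linarith [ht.2], by linarith [ht.1]⟩
  refine ⟨fun t ht => ?_, fun t ht => h.a_pos _ (hmem t ht), fun t ht => h.b_pos _ (hmem t ht),
    fun t ht => ?_⟩
  · have hd : ∀ i, HasDerivAt (fun t => y (-t) i) (-flowField Λ ε (y (-t)) i) t := fun i =>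
      (((h.flowsAt _ (hmem t ht)).coord i).scomp t (hasDerivAt_neg t)).congr_deriv (by simp)
    unfold FlowsAt
    rw [hasDerivAt_pi]
    intro i
    fin_cases i
    · exact (hd 0).congr_deriv (by simp [flowField, Recollapse.timeReverse])
    · exact (hd 1).congr_deriv (by simp [flowField, Recollapse.timeReverse])
    · exact (hd 2).neg.congr_deriv (by simp [flowField, Recollapse.timeReverse]; ring)
    · exact (hd 3).neg.congr_deriv (by simp [flowField, Recollapse.timeReverse]; ring)
    · exact (hd 4).congr_deriv (by simp [flowField, Recollapse.timeReverse])
    · exact (hd 5).neg.congr_deriv (by simp [flowField, Recollapse.timeReverse]; ring)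
  · rw [← h.constraint _ (hmem t ht)]
    simp [hamiltonian, Recollapse.timeReverse]

end Reversal

/-! ### From solutions of the first-order system back to spacetimes. -/

namespace IsFlow

variable {Λ ε : ℝ} {y : ℝ → Fin 6 → ℝ} {J : Set ℝ}

/-- Bootstrap: y' is a smooth function of y, so each order of regularity gives the next. -/
lemma contDiffOn (h : IsFlow Λ ε y J) (hJ : IsOpen J) (n : ℕ) : ContDiffOn ℝ n y J := by
  induction n with
  | zero =>
    exact contDiffOn_zero.2 fun t ht => (h.flowsAt t ht).continuousAt.continuousWithinAt
  | succ n ih =>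
    rw [Nat.cast_add, Nat.cast_one, contDiffOn_succ_iff_deriv_of_isOpen hJ]
    refine ⟨fun t ht => (h.flowsAt t ht).differentiableAt.differentiableWithinAt, by simp, ?_⟩
    have : ContDiffOn ℝ n (flowField Λ ε ∘ y) J := fun t ht =>
      (contDiffAt_flowField Λ ε (h.b_pos t ht).ne' n).comp_contDiffWithinAt t (ih t ht)
    exact this.congr fun t ht => (h.flowsAt t ht).deriv

/-- The homogeneous spacetime described by a solution of the reduced equations. -/
def toHomogeneous (h : IsFlow Λ ε y J) (hJ : IsOpen J) (hJ' : J.OrdConnected)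
    (hne : J.Nonempty) : Homogeneous where
  I := J
  a t := y t 0
  b t := y t 1
  φ t := y t 4
  isOpen := hJ
  ordConnected := hJ'
  nonempty := hne
  contDiffOn_a := contDiffOn_pi.1 (h.contDiffOn hJ 2) 0
  contDiffOn_b := contDiffOn_pi.1 (h.contDiffOn hJ 2) 1
  contDiffOn_φ := contDiffOn_pi.1 (h.contDiffOn hJ 2) 4
  a_pos := h.a_pos
  b_pos := h.b_pos

lemma isReducedSolutionAt (h : IsFlow Λ ε y J) (hJ : IsOpen J) {t : ℝ} (ht : t ∈ J) :
    IsReducedSolutionAt ε Λ (fun t => y t 0) (fun t => y t 1) (fun t => y t 4) t := by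
  have ha := (h.a_pos t ht).ne'
  have hb := (h.b_pos t ht).ne'
  have hc := fun i => (h.flowsAt t ht).coord i
  have hd : ∀ i, deriv (fun t => y t i) =ᶠ[𝓝 t] fun t => flowField Λ ε (y t) i := fun i => by
    filter_upwards [hJ.mem_nhds ht] with s hs using ((h.flowsAt s hs).coord i).deriv
  have h0 : deriv (fun t => y t 0) t = y t 0 * y t 2 := (hc 0).deriv
  have h1 : deriv (fun t => y t 1) t = y t 1 * y t 3 := (hc 1).deriv
  have h4 : deriv (fun t => y t 4) t = y t 5 := (hc 4).deriv
  have h00 : deriv (deriv fun t => y t 0) t =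
      y t 0 * y t 2 * y t 2 + y t 0 * (Λ - y t 2 * (y t 2 + 2 * y t 3)) := by
    rw [(hd 0).deriv_eq]
    exact ((hc 0).mul (hc 2)).deriv
  have h11 : deriv (deriv fun t => y t 1) t =
      y t 1 * y t 3 * y t 3
        + y t 1 * (Λ - ε / y t 1 ^ 2 - y t 3 * (y t 2 + 2 * y t 3)) := by
    rw [(hd 1).deriv_eq]
    exact ((hc 1).mul (hc 3)).deriv
  have h44 : deriv (deriv fun t => y t 4) t = -(y t 2 + 2 * y t 3) * y t 5 := by
    rw [(hd 4).deriv_eq]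
    exact (hc 5).deriv
  have hH : y t 0 * y t 2 / y t 0 = y t 2 := mul_div_cancel_left₀ _ ha
  have hK : y t 1 * y t 3 / y t 1 = y t 3 := mul_div_cancel_left₀ _ hb
  have hcon := h.constraint t ht
  simp only [hamiltonian] at hcon
  constructor
  · rw [h00, h0, h1, hH, hK]
    field_simp
    ring
  · rw [h11, h0, h1, hH, hK]
    field_simp
    ring
  · rw [h0, h1, hH, hK, h4]
    linear_combination hcon
  · rw [h0, h1, hH, hK, h4, h44]
    ring

end IsFlow

/-! ### Maximal solutions: lifetime, timelike curves, inextendibility, curvature bound. -/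

namespace Homogeneous

variable {Λ ε : ℝ}

/-- The solution of the reduced equations in first-order form described by a homogeneous
spacetime. -/
def state (S : Homogeneous) (t : ℝ) : Fin 6 → ℝ :=
  ![S.a t, S.b t, deriv S.a t / S.a t, deriv S.b t / S.b t, S.φ t, deriv S.φ t]

lemma expansion_state (S : Homogeneous) (t : ℝ) :
    expansion (S.state t) = deriv S.a t / S.a t + 2 * (deriv S.b t / S.b t) := by
  simp [expansion, state]

lemma isFlow_state {S : Homogeneous}
    (h : ∀ t ∈ S.I, IsReducedSolutionAt ε Λ S.a S.b S.φ t) : IsFlow Λ ε S.state S.I := by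
  refine ⟨fun t ht => ?_, S.a_pos, S.b_pos, fun t ht => ?_⟩
  · have hI := S.isOpen.mem_nhds ht
    have ha := (S.a_pos t ht).ne'
    have hb := (S.b_pos t ht).ne'
    have hca := S.contDiffOn_a.contDiffAt hI
    have hcb := S.contDiffOn_b.contDiffAt hI
    have hcφ := S.contDiffOn_φ.contDiffAt hI
    have da := (hca.differentiableAt (by simp)).hasDerivAt
    have db := (hcb.differentiableAt (by simp)).hasDerivAt
    have dφ := (hcφ.differentiableAt (by simp)).hasDerivAt
    have dda := (differentiableAt_deriv hca).hasDerivAt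
    have ddb := (differentiableAt_deriv hcb).hasDerivAt
    have ddφ := (differentiableAt_deriv hcφ).hasDerivAt
    obtain ⟨h1, h2, -, h4⟩ := h t ht
    have e : ∀ x x' x'' : ℝ, x ≠ 0 → (x'' * x - x' * x') / x ^ 2 = x'' / x - (x' / x) ^ 2 := by
      intro x x' x'' hx
      field_simp
    unfold FlowsAt
    rw [hasDerivAt_pi]
    intro i
    fin_cases i
    · exact da.congr_deriv (by simp [flowField, state]; field_simp)
    · exact db.congr_deriv (by simp [flowField, state]; field_simp)
    · refine (dda.div da ha).congr_deriv ?_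
      rw [e _ _ _ ha]
      simp only [flowField, state, Fin.reduceFinMk, Matrix.cons_val]
      linear_combination h1
    · refine (ddb.div db hb).congr_deriv ?_
      rw [e _ _ _ hb]
      simp only [flowField, state, Fin.reduceFinMk, Matrix.cons_val]
      linear_combination h2
    · exact dφ.congr_deriv (by simp [flowField, state])
    · refine ddφ.congr_deriv ?_
      simp only [flowField, state, Fin.reduceFinMk, Matrix.cons_val]
      linear_combination h4
  · simp only [hamiltonian, state, Matrix.cons_val]
    linear_combination (h t ht).constraint

/-- The lifetime of a solution is a bounded interval. -/
lemma exists_eq_Ioo {S : Homogeneous} (hΛ : Λ < 0) (h : IsFlow Λ ε S.state S.I) :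
    ∃ Tm Tp : ℝ, Tm < Tp ∧ S.I = Ioo Tm Tp := by
  set m := min (-Λ) (1 / 3)
  have hm : 0 < m := lt_min (by linarith) (by norm_num)
  obtain ⟨t₀, ht₀⟩ := S.nonempty
  have hle : ∀ s ∈ S.I, ∀ t ∈ S.I, t - s ≤ Real.pi / m := fun s hs t ht => by
    rw [le_div_iff₀ hm, mul_comm]
    exact h.length_le hΛ S.ordConnected.convex hs ht
  have hA : BddAbove S.I := ⟨t₀ + Real.pi / m, fun t ht => by linarith [hle t₀ ht₀ t ht]⟩
  have hB : BddBelow S.I := ⟨t₀ - Real.pi / m, fun t ht => by linarith [hle t ht t₀ ht₀]⟩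
  have hsub : S.I ⊆ Ioo (sInf S.I) (sSup S.I) := by
    intro t ht
    -- Openness keeps the infimum and supremum out of the interval.
    obtain ⟨l, u, htlu, hlu⟩ := mem_nhds_iff_exists_Ioo_subset.1 (S.isOpen.mem_nhds ht)
    obtain ⟨r, hr⟩ := exists_between htlu.2
    obtain ⟨r', hr'⟩ := exists_between htlu.1
    exact ⟨(csInf_le hB (hlu ⟨hr'.1, hr'.2.trans htlu.2⟩)).trans_lt hr'.2,
      hr.1.trans_le (le_csSup hA (hlu ⟨htlu.1.trans hr.1, hr.2⟩))⟩
  refine ⟨sInf S.I, sSup S.I, (hsub ht₀).1.trans (hsub ht₀).2, hsub.antisymm ?_⟩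
  exact IsConnected.Ioo_csInf_csSup_subset ⟨S.nonempty, S.ordConnected.isPreconnected⟩ hB hA

variable {F : Type*} [TopologicalSpace F] [ChartedSpace (EuclideanSpace ℝ (Fin 2)) F]
  [IsManifold (𝓡 2) ∞ F] {σ : SurfaceMetric F} {S : Homogeneous}

/-- A timelike curve is not longer than the lifetime of the universe. -/
lemma IsProperTimeCurve.length_le {Tm Tp : ℝ} (hT : Tm < Tp) (hI : S.I = Ioo Tm Tp)
    {s₀ s₁ : ℝ} {t θ : ℝ → ℝ} {p : ℝ → F} (h : S.IsProperTimeCurve σ s₀ s₁ t θ p) :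
    s₁ - s₀ ≤ Tp - Tm := by
  have hspeed : ∀ s ∈ Ioo s₀ s₁, 1 ≤ deriv t s ^ 2 := fun s hs => by
    have h1 := h.unit_speed s hs
    have h2 : 0 ≤ σ.inner (p s) (mfderiv 𝓘(ℝ, ℝ) (𝓡 2) p s (1 : ℝ))
        (mfderiv 𝓘(ℝ, ℝ) (𝓡 2) p s (1 : ℝ)) := by
      by_cases hv : mfderiv 𝓘(ℝ, ℝ) (𝓡 2) p s (1 : ℝ) = 0
      · rw [hv, map_zero]
      · exact (σ.pos _ _ hv).le
    nlinarith [mul_nonneg (sq_nonneg (S.b (t s))) h2,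
      mul_nonneg (sq_nonneg (S.a (t s))) (sq_nonneg (deriv θ s))]
  by_contra! hlt
  -- Trimming η from each end gives a closed interval for the mean value theorem, whose length is
  -- the average of s₁ - s₀ and Tp - Tm and so still exceeds Tp - Tm.
  set η := (s₁ - s₀ - (Tp - Tm)) / 4 with hη
  have hη0 : 0 < η := by linarith
  have hss : s₀ + η < s₁ - η := by linarith
  have hsub : Icc (s₀ + η) (s₁ - η) ⊆ Ioo s₀ s₁ := fun s hs =>
    ⟨by linarith [hs.1], by linarith [hs.2]⟩
  obtain ⟨c, hc, hc'⟩ := exists_deriv_eq_slope t hss (h.contDiffOn_t.continuousOn.mono hsub)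
    ((h.contDiffOn_t.differentiableOn (by simp)).mono (Ioo_subset_Icc_self.trans hsub))
  have h1 := hspeed c (hsub (Ioo_subset_Icc_self hc))
  have hm1 := hI ▸ h.mem _ (hsub (left_mem_Icc.2 hss.le))
  have hm2 := hI ▸ h.mem _ (hsub (right_mem_Icc.2 hss.le))
  have hpos : 0 < s₁ - η - (s₀ + η) := by linarith
  rw [hc', div_pow, one_le_div (by positivity)] at h1
  have h2 := sq_le_sq.1 h1
  rw [abs_of_pos hpos] at h2
  have h3 : |t (s₁ - η) - t (s₀ + η)| < Tp - Tm :=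
    abs_lt.2 ⟨by linarith [hm1.2, hm2.1], by linarith [hm1.1, hm2.2]⟩
  linarith

variable [Nonempty F]

lemma IsMaximalSolution.isFlow_state (hσ : HasConstantCurvature σ ε)
    (hS : S.IsMaximalSolution σ Λ) : IsFlow Λ ε S.state S.I :=
  Homogeneous.isFlow_state ((S.solvesEinsteinScalar_iff hσ Λ).1 hS.1)

/-- A maximal solution cannot be continued as a solution of the reduced equations. -/
lemma IsMaximalSolution.eq_of_isFlow (hσ : HasConstantCurvature σ ε)
    (hS : S.IsMaximalSolution σ Λ) {z : ℝ → Fin 6 → ℝ} {J : Set ℝ} (hz : IsFlow Λ ε z J)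
    (hJ : IsOpen J) (hJ' : J.OrdConnected) (hSJ : S.I ⊆ J) (h : EqOn z S.state S.I) :
    J = S.I := by
  refine hS.2 (hz.toHomogeneous hJ hJ' (S.nonempty.mono hSJ))
    ((solvesEinsteinScalar_iff hσ Λ _).2 fun t ht => hz.isReducedSolutionAt hJ ht)
    ⟨hSJ, fun t ht => ?_, fun t ht => ?_, fun t ht => ?_⟩
  · exact congrFun (h ht) 0
  · exact congrFun (h ht) 1
  · exact congrFun (h ht) 4

lemma IsMaximalSolution.futureInextendible (hσ : HasConstantCurvature σ ε)
    (hS : S.IsMaximalSolution σ Λ) {Tm Tp : ℝ} (hI : S.I = Ioo Tm Tp) (hT : Tm < Tp) :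
    FutureInextendible Λ ε S.state Tm Tp := by
  intro δ hδ z hz hzy
  have := hS.eq_of_isFlow hσ hz isOpen_Ioo ordConnected_Ioo
    (hI ▸ Ioo_subset_Ioo_right (by linarith)) (hI ▸ hzy)
  have hmem : Tp ∈ Ioo Tm (Tp + δ) := ⟨hT, by linarith⟩
  rw [this, hI] at hmem
  exact lt_irrefl _ hmem.2

lemma IsMaximalSolution.pastInextendible (hσ : HasConstantCurvature σ ε)
    (hS : S.IsMaximalSolution σ Λ) {Tm Tp : ℝ} (hI : S.I = Ioo Tm Tp) (hT : Tm < Tp) :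
    FutureInextendible Λ ε (timeReverse S.state) (-Tp) (-Tm) := by
  intro δ hδ z hz hzy
  have hz' := hz.timeReverse
  rw [show -(-Tm + δ) = Tm - δ by ring, neg_neg] at hz'
  have := hS.eq_of_isFlow hσ hz' isOpen_Ioo ordConnected_Ioo
    (hI ▸ Ioo_subset_Ioo_left (by linarith)) fun t ht => by
      rw [hI] at ht
      have := hzy (x := -t) ⟨by linarith [ht.2], by linarith [ht.1]⟩
      rw [← timeReverse_timeReverse S.state]
      simp only [timeReverse] at this ⊢
      rw [this]
  have hmem : Tm ∈ Ioo (Tm - δ) Tp := ⟨by linarith, hT⟩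
  rw [this, hI] at hmem
  exact lt_irrefl _ hmem.1

/-- The Kretschmann scalar is bounded below by the kinetic energy of the scalar field. -/
lemma le_kretschmannScalar (hσ : HasConstantCurvature σ ε) (hS : S.SolvesEinsteinScalar σ Λ)
    {x : ℝ × Circle × F} (hx : x ∈ S.carrier F) :
    8 * Real.pi * S.state x.1 5 ^ 2 + (-Λ - 1) ≤ S.kretschmannScalar σ x := by
  obtain ⟨h1, h2, h3, -⟩ := (S.solvesEinsteinScalar_iff hσ Λ).1 hS x.1 hx
  rw [kretschmannScalar_eq hσ S hx]
  simp only [sectional, state, Matrix.of_apply, Matrix.cons_val, Matrix.cons_val']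
  set α := deriv (deriv S.a) x.1 / S.a x.1
  set β := deriv (deriv S.b) x.1 / S.b x.1
  set μ := deriv S.a x.1 / S.a x.1 * (deriv S.b x.1 / S.b x.1)
  set ν := (deriv S.b x.1 / S.b x.1) ^ 2 + ε / S.b x.1 ^ 2
  have hsum : 8 * Real.pi * deriv S.φ x.1 ^ 2 - Λ = -(α + 2 * β) := by
    linear_combination h1 + 2 * h2 - 2 * h3
  have hX : 8 * Real.pi * deriv S.φ x.1 ^ 2 + (-Λ - 1) = -(α + 2 * β) - 1 := by
    linear_combination hsum
  rw [hX]
  -- With u = α + 2β, Cauchy–Schwarz gives 4(α² + 2β²) ≥ (4/3)u², which is at least -u - 1; μ and ν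
  -- only add squares.
  nlinarith [sq_nonneg (α + 2 * β + 1), sq_nonneg (α - β), sq_nonneg μ, sq_nonneg ν]

end Homogeneous

end Recollapse

end

/-! ### Assembly of the two ends. -/

theorem mainTheorem5
    {F : Type*} [TopologicalSpace F] [ChartedSpace (EuclideanSpace ℝ (Fin 2)) F]
    [IsManifold (𝓡 2) ∞ F] [Nonempty F]
    (σ : Recollapse.SurfaceMetric F) (ε : ℝ) (hε : ε = -1 ∨ ε = 0 ∨ ε = 1)
    (hσ : Recollapse.HasConstantCurvature σ ε)
    (Λ : ℝ) (hΛ : Λ < 0)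
    (S : Recollapse.Homogeneous) (hS : S.IsMaximalSolution σ Λ)
    (hφ : ∃ t ∈ S.I, deriv S.φ t ≠ 0) :
    ∃ Tm Tp : ℝ, Tm < Tp ∧ S.I = Ioo Tm Tp ∧
      -- the slices of constant time are a foliation by hypersurfaces of constant mean curvature
      S.IsCMCFoliation σ (fun x : ℝ × Circle × F => x.1) ∧
      -- the mean curvature of the leaves takes all real values
      (∀ h : ℝ, ∃ x ∈ S.carrier F, S.leafMeanCurvature σ (fun y => y.1) x = h) ∧
      -- both singularities are crushing
      Tendsto (S.leafMeanCurvature σ (fun y : ℝ × Circle × F => y.1))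
        (comap Prod.fst (𝓝[>] Tm)) atTop ∧
      Tendsto (S.leafMeanCurvature σ (fun y : ℝ × Circle × F => y.1))
        (comap Prod.fst (𝓝[<] Tp)) atBot ∧
      -- both singularities are curvature singularities
      Tendsto (S.kretschmannScalar (F := F) σ) (comap Prod.fst (𝓝[>] Tm)) atTop ∧
      Tendsto (S.kretschmannScalar (F := F) σ) (comap Prod.fst (𝓝[<] Tp)) atTop ∧
      -- recollapse: no timelike curve has proper time longer than the lifetime of the universe
      (∀ (s₀ s₁ : ℝ) (t θ : ℝ → ℝ) (p : ℝ → F),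
        S.IsProperTimeCurve σ s₀ s₁ t θ p → s₁ - s₀ ≤ Tp - Tm) := by
  have hflow := hS.isFlow_state hσ
  obtain ⟨Tm, Tp, hT, hI⟩ := Recollapse.Homogeneous.exists_eq_Ioo hΛ hflow
  obtain ⟨t₀, ht₀, hφ₀⟩ := hφ
  have hfut := hS.futureInextendible hσ hI hT
  have hpast := hS.pastInextendible hσ hI hT
  rw [hI] at hflow ht₀
  have hflow' := hflow.timeReverse
  have hT' : -Tp < -Tm := neg_lt_neg hT
  have hmem : ∀ t ∈ Ioo Tm Tp, ∀ x : ℝ × Circle × F, x.1 = t → x ∈ S.carrier F :=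
    fun t ht x hx => by
      change x.1 ∈ S.I
      rw [hI, hx]
      exact ht
  have hleaf : ∀ x ∈ S.carrier F, S.leafMeanCurvature σ (fun y => y.1) x =
      Recollapse.expansion (S.state x.1) := fun x hx => by
    rw [S.leafMeanCurvature_eq σ hx, S.expansion_state]
  have hθp := hflow.tendsto_expansion_atBot hΛ hfut hT
  have hθm : Tendsto (fun t => Recollapse.expansion (S.state t)) (𝓝[>] Tm) atTop := by
    have := tendsto_neg_atBot_atTop.comp
      ((hflow'.tendsto_expansion_atBot hΛ hpast hT').comp (tendsto_neg_nhdsGT (a := Tm)))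
    refine this.congr fun t => ?_
    simp [Recollapse.expansion, Recollapse.timeReverse]
    ring
  -- The lower bound depends on time alone, which makes the blow-up uniform on slices: this is
  -- convergence along the filter pulled back from time.
  have hkin : ∀ {l : Filter ℝ}, Tendsto (fun t => S.state t 5 ^ 2) l atTop →
      (∀ᶠ t in l, t ∈ Ioo Tm Tp) →
      Tendsto (S.kretschmannScalar (F := F) σ) (comap Prod.fst l) atTop := fun hl hl' => by
    have h1 := tendsto_atTop_add_const_right _ (-Λ - 1)
      (hl.const_mul_atTop (mul_pos (by norm_num : (0 : ℝ) < 8) Real.pi_pos))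
    refine tendsto_atTop_mono' _ ?_ (h1.comp tendsto_comap)
    filter_upwards [tendsto_comap.eventually hl'] with x hx
    exact S.le_kretschmannScalar hσ hS.1 (hmem _ hx x rfl)
  have hkp := hflow.tendsto_kinetic_atTop hΛ hfut ht₀ (by simpa [Recollapse.Homogeneous.state])
  have hkm : Tendsto (fun t => S.state t 5 ^ 2) (𝓝[>] Tm) atTop := by
    have := (hflow'.tendsto_kinetic_atTop hΛ hpast (t₀ := -t₀)
      ⟨by linarith [ht₀.2], by linarith [ht₀.1]⟩
      (by simpa [Recollapse.timeReverse, Recollapse.Homogeneous.state])).comp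
        (tendsto_neg_nhdsGT (a := Tm))
    refine this.congr fun t => ?_
    simp [Recollapse.timeReverse]
  have hnm : ∀ᶠ t in 𝓝[>] Tm, t ∈ Ioo Tm Tp := Ioo_mem_nhdsGT hT
  have hnp : ∀ᶠ t in 𝓝[<] Tp, t ∈ Ioo Tm Tp := Ioo_mem_nhdsLT hT
  refine ⟨Tm, Tp, hT, hI, S.isCMCFoliation σ, fun h => ?_, ?_, ?_, hkin hkm hnm, hkin hkp hnp,
    fun s₀ s₁ t θ p hc => hc.length_le hT hI⟩
  -- Intermediate value theorem for θ, between a late time with θ ≤ h and an early time with θ ≥ h.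
  · obtain ⟨t₁, h₁, ht₁⟩ := ((hθp.eventually_le_atBot h).and hnp).exists
    obtain ⟨t₂, h₂, ht₂⟩ := ((hθm.eventually_ge_atTop h).and hnm).exists
    obtain ⟨t, ht, rfl⟩ := isPreconnected_Ioo.intermediate_value ht₁ ht₂
      (fun t ht => (hflow.hasDerivAt_expansion ht).continuousAt.continuousWithinAt) ⟨h₁, h₂⟩
    obtain ⟨p⟩ := ‹Nonempty F›
    exact ⟨(t, 1, p), hmem t ht _ rfl, hleaf _ (hmem t ht _ rfl)⟩
  · refine (hθm.comp tendsto_comap).congr' ?_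
    filter_upwards [tendsto_comap.eventually hnm] with x hx
    exact (hleaf x (hmem _ hx x rfl)).symm
  · refine (hθp.comp tendsto_comap).congr' ?_
    filter_upwards [tendsto_comap.eventually hnp] with x hx
    exact (hleaf x (hmem _ hx x rfl)).symm
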